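/- A \emph{game graph} $(G,w)$ is a finite directed graph $G=(V,E)$ in which every node has out-degree at least one, with integer edge weights $w:E\to\mathbb{Z}$ and a partition $V=V_A\cup V_B$ of the nodes between two players, Alice and Bob. It is \emph{complete bipartite} if no edge joins two nodes of the same player and, for all $u\in V_A$, $v\in V_B$, both $(u,v)$ and $(v,u)$ are edges. A (positional) strategy $\sigma$ of Alice ($\tau$ of Bob) maps every node of $V_A$ (of $V_B$) to one of its out-neighbours; a pair $(\sigma,\tau)$ and a start node $s$ determine an infinite path $s=v_0,v_1,v_2,\dots$. \emph{Energy games.} Let $e^*_{\sigma,\tau}(s)$ be the least $e\in\{0,1,2,\dots\}$ such that $e+\sum_{j<i}w(v_j,v_{j+1})\ge 0$ for all $i\ge 0$, and $\infty$ if there is none. The minimal energy at $s$ is $e^*_{G,w}(s)=\min_\sigma\max_\tau e^*_{\sigma,\tau}(s)$. The \emph{value problem of energy games} is: given $(G,w)$, compute $e^*_{G,w}(s)$ for every node $s$. \emph{Mean-payoff games.} Let $\mu_{\sigma,\tau}(s)$ be the average weight $\sum_{(u,v)\in C}w(u,v)/|C|$ of the cycle $C$ that the path from $s$ eventually follows.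 The value at $s$ is $\mathrm{val}_{G,w}(s)=\max_\sigma\min_\tau \mu_{\sigma,\tau}(s)$. The \emph{mean-payoff game problem} is: given $(G,w)$, compute $\mathrm{val}_{G,w}(s)$ for every node $s$. Two problems are \emph{polynomial-time equivalent} if each of them is polynomial-time Turing reducible to the other, that is, can be solved in polynomial time (weights being encoded in binary) by an algorithm with an oracle for the other one. \textbf{Corollary.} The value problem of energy games on complete bipartite game graphs is polynomial-time equivalent to the value problem of energy games on general game graphs. Moreover, the mean-payoff game problem on complete bipartite game graphs is polynomial-time equivalent to the mean-payoff game problem on general game graphs. -/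

import Mathlib

namespace EnergyGames

/-! ### Game graphs -/

/-- A weighted game graph on the node set `V`. `alice u = true` means that `u` belongs to Alice
and `alice u = false` that it belongs to Bob. `weight u v = none` means that there is no edge from
`u` to `v`, and `weight u v = some z` that there is one, of weight `z`. Every node has out-degree
at least one. -/
@[ext]
structure GameGraph (V : Type) where
  alice : V → Bool
  weight : V → V → Option ℤ
  exists_edge : ∀ u, ∃ v, (weight u v).isSome

namespace GameGraph

variable {V : Type}

/-- `(u, v)` is an edge. -/
def Edge (G : GameGraph V) (u v : V) : Prop := (G.weight u v).isSome

/-- Complete bipartite game graphs: no edge joins two nodes of the same player, and there is an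
edge from every node of either player to every node of the other. -/
def IsCompleteBipartite (G : GameGraph V) : Prop :=
  (∀ u v, G.alice u = G.alice v → ¬ G.Edge u v) ∧ (∀ u v, G.alice u ≠ G.alice v → G.Edge u v)

/-- Positional strategies: `G.Strategy true` are those of Alice, `G.Strategy false` those of Bob.
Every node of the player is mapped to one of its out-neighbours. -/
def Strategy (G : GameGraph V) (b : Bool) : Type :=
  ∀ u : V, G.alice u = b → {v : V // G.Edge u v}

instance (G : GameGraph V) (b : Bool) : Nonempty (G.Strategy b) :=
  ⟨fun u _ => ⟨(G.exists_edge u).choose, (G.exists_edge u).choose_spec⟩⟩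

instance [Finite V] (G : GameGraph V) (b : Bool) : Finite (G.Strategy b) := by
  unfold Strategy; infer_instance

/-- The unique out-neighbour of a node in the graph `G(σ, τ)`. -/
def next (G : GameGraph V) (σ : G.Strategy true) (τ : G.Strategy false) (u : V) : V :=
  match h : G.alice u with
  | true => (σ u h).1
  | false => (τ u h).1

/-- The total weight of the path of length `i` from `s` in `G(σ, τ)`. All the steps of this path
are edges, so the default value of `Option.getD` is never used. -/
def pathWeight (G : GameGraph V) (σ : G.Strategy true) (τ : G.Strategy false) (s : V) (i : ℕ) :
    ℤ :=
  ∑ j ∈ Finset.range i, (G.weight ((G.next σ τ)^[j] s) ((G.next σ τ)^[j + 1] s)).getD 0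

/-- Alice wins the energy game from `s` with initial energy `k` when `σ` and `τ` are played:
the energy never drops below zero. -/
def Sustains (G : GameGraph V) (σ : G.Strategy true) (τ : G.Strategy false) (s : V) (k : ℕ) :
    Prop :=
  ∀ i : ℕ, 0 ≤ (k : ℤ) + G.pathWeight σ τ s i

/-- The least initial energy with which Alice wins from `s` when `σ` and `τ` are played
(`⊤` if no finite energy suffices). -/
noncomputable def playEnergy (G : GameGraph V) (σ : G.Strategy true) (τ : G.Strategy false)
    (s : V) : ℕ∞ :=
  ⨅ (k : ℕ) (_ : G.Sustains σ τ s k), (k : ℕ∞)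

/-- The minimal sufficient energy at `s`. -/
noncomputable def minEnergy (G : GameGraph V) (s : V) : ℕ∞ :=
  ⨅ σ : G.Strategy true, ⨆ τ : G.Strategy false, G.playEnergy σ τ s

/-- The mean payoff from `s` when `σ` and `τ` are played, that is, the average weight of the cycle
reachable from `s` in `G(σ, τ)`. After `|V|` moves the play is on this cycle, whose length is
the minimal period, under `next`, of the node reached then. -/
noncomputable def playMean [Fintype V] (G : GameGraph V) (σ : G.Strategy true)
    (τ : G.Strategy false) (s : V) : ℚ :=
  let c : V := (G.next σ τ)^[Fintype.card V] s
  let p : ℕ := Function.minimalPeriod (G.next σ τ) c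
  (G.pathWeight σ τ c p : ℚ) / (p : ℚ)

/-- The value at `s` of the mean-payoff game, in which Alice maximises the mean payoff and Bob
minimises it. -/
noncomputable def meanValue [Fintype V] (G : GameGraph V) (s : V) : ℚ :=
  letI := Fintype.ofFinite (G.Strategy true)
  letI := Fintype.ofFinite (G.Strategy false)
  Finset.univ.sup' Finset.univ_nonempty fun σ : G.Strategy true =>
    Finset.univ.inf' Finset.univ_nonempty fun τ : G.Strategy false => G.playMean σ τ s

end GameGraph

/-! ### Machine model

Programs work on finite binary trees with integer leaves. Integers are counted with their binary
length, and every elementary operation is charged for the size of its input and of its output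
(the logarithmic cost criterion), so that polynomial time is the same as for Turing machines. -/

/-- Binary trees with integer leaves. -/
inductive Data where
  | int (z : ℤ)
  | pair (a b : Data)

namespace Data

/-- The number of symbols needed to write down a tree, with its integers in binary. -/
def size : Data → ℕ
  | int z => Nat.size z.natAbs + 1
  | pair a b => a.size + b.size + 1

def fst : Data → Data
  | int _ => int 0
  | pair a _ => a

def snd : Data → Data
  | int _ => int 0
  | pair _ b => b

def toInt : Data → ℤ
  | int z => z
  | pair _ _ => 0

def isPair : Data → Bool
  | int _ => false
  | pair _ _ => true

/-- `0` counts as false and everything else as true. -/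
def Truthy (d : Data) : Prop := d ≠ int 0

def ofBool (b : Bool) : Data := int (if b then 1 else 0)

/-- Lists are nested pairs ending in `0`. -/
def ofList : List Data → Data
  | [] => int 0
  | a :: l => pair a (ofList l)

def ofOption : Option ℤ → Data
  | none => int 0
  | some z => pair (int z) (int 0)

/-- An extended natural number: itself, or `-1` for infinity. -/
noncomputable def ofENat (e : ℕ∞) : Data :=
  open Classical in if e = ⊤ then int (-1) else int e.toNat

/-- A rational number: numerator and denominator in lowest terms. -/
def ofRat (q : ℚ) : Data := pair (int q.num) (int q.den)

theorem ofBool_injective : Function.Injective ofBool := by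
  intro a b h
  cases a <;> cases b <;> simp_all [ofBool]

theorem ofOption_injective : Function.Injective ofOption := by
  intro a b h
  cases a <;> cases b <;> simp_all [ofOption]

theorem ofList_injective : Function.Injective ofList := by
  intro l
  induction l with
  | nil => intro m h; cases m <;> simp_all [ofList]
  | cons a l ih =>
    intro m h
    cases m with
    | nil => simp [ofList] at h
    | cons b m =>
      simp only [ofList, pair.injEq] at h
      rw [h.1, ih h.2]

end Data

/-- Elementary operations. The binary ones act on the two components of a pair. -/
inductive Prim where
  | id
  | const (z : ℤ)
  | fst
  | snd
  | isPair
  | add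
  | sub
  | mul
  | div
  | le

def Prim.eval : Prim → Data → Data
  | id, x => x
  | const z, _ => .int z
  | fst, x => x.fst
  | snd, x => x.snd
  | isPair, x => .ofBool x.isPair
  | add, x => .int (x.fst.toInt + x.snd.toInt)
  | sub, x => .int (x.fst.toInt - x.snd.toInt)
  | mul, x => .int (x.fst.toInt * x.snd.toInt)
  | div, x => .int (x.fst.toInt / x.snd.toInt)
  | le, x => .ofBool (decide (x.fst.toInt ≤ x.snd.toInt))

/-- Programs with oracle calls. -/
inductive Code where
  | prim (o : Prim)
  | pair (f g : Code)
  | comp (g f : Code)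
  | ite (b f g : Code)
  | loop (b f : Code)
  | oracle

/-- `Runs O c x y t`: with the oracle `O`, the program `c` started on `x` halts with output `y`
after `t` steps. -/
inductive Runs (O : Data → Data) : Code → Data → Data → ℕ → Prop where
  /-- an elementary operation -/
  | prim (o : Prim) (x : Data) :
      Runs O (.prim o) x (o.eval x) (1 + x.size + (o.eval x).size)
  /-- run `f` and `g` on the same input and pair the results -/
  | pair {f g : Code} {x y z : Data} {s t : ℕ} :
      Runs O f x y s → Runs O g x z t → Runs O (.pair f g) x (.pair y z) (1 + s + t)
  /-- run `f` and then `g` -/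
  | comp {f g : Code} {x y z : Data} {s t : ℕ} :
      Runs O f x y s → Runs O g y z t → Runs O (.comp g f) x z (1 + s + t)
  /-- test `b`, then run `f` -/
  | ite_true {b f g : Code} {x y z : Data} {s t : ℕ} :
      Runs O b x y s → y.Truthy → Runs O f x z t → Runs O (.ite b f g) x z (1 + s + t)
  /-- test `b`, then run `g` -/
  | ite_false {b f g : Code} {x y z : Data} {s t : ℕ} :
      Runs O b x y s → ¬ y.Truthy → Runs O g x z t → Runs O (.ite b f g) x z (1 + s + t)
  /-- `loop b f` is "while `b` do `f`": the test fails, and the current value is returned -/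
  | loop_done {b f : Code} {x y : Data} {s : ℕ} :
      Runs O b x y s → ¬ y.Truthy → Runs O (.loop b f) x x (1 + s)
  /-- the test of the loop succeeds, `f` is run once, and the loop is entered again -/
  | loop_step {b f : Code} {x y z r : Data} {s t u : ℕ} :
      Runs O b x y s → y.Truthy → Runs O f x z t → Runs O (.loop b f) z r u →
        Runs O (.loop b f) x r (1 + s + t + u)
  /-- replace the current value by the answer of the oracle to it -/
  | oracle (x : Data) :
      Runs O .oracle x (O x) (1 + x.size + (O x).size)

/-! ### Computational problems and polynomial-time equivalence -/

/-- A computational problem: instances, written down as trees, and the answer to compute for each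
of them. -/
structure Problem where
  Inst : Type
  encode : Inst → Data
  encode_injective : Function.Injective encode
  answer : Inst → Data

/-- The oracle `O` answers every instance of `Q` correctly. Nothing is known about its answers to
trees that do not encode an instance of `Q`. -/
def Problem.SolvedBy (Q : Problem) (O : Data → Data) : Prop :=
  ∀ x : Q.Inst, O (Q.encode x) = Q.answer x

/-- Polynomial-time Turing reducibility: one program, with a polynomial time bound in the size of
the input, solves `P` with any oracle that solves `Q`. -/
def PolyTimeReducible (P Q : Problem) : Prop :=
  ∃ (c : Code) (p : Polynomial ℕ), ∀ O : Data → Data, Q.SolvedBy O →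
    ∀ x : P.Inst, ∃ t : ℕ, t ≤ p.eval (P.encode x).size ∧ Runs O c (P.encode x) (P.answer x) t

def PolyTimeEquivalent (P Q : Problem) : Prop :=
  PolyTimeReducible P Q ∧ PolyTimeReducible Q P

/-! ### The value problems -/

/-- A game graph with nodes `0, …, n - 1`. -/
structure Instance where
  n : ℕ
  graph : GameGraph (Fin n)

/-- An instance is written down as the list, over all nodes `u`, of the owner of `u` and the
row of `u` in the weighted adjacency matrix. -/
def Instance.encode (I : Instance) : Data :=
  Data.ofList (List.ofFn fun u : Fin I.n =>
    Data.pair (Data.ofBool (I.graph.alice u))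
      (Data.ofList (List.ofFn fun v : Fin I.n => Data.ofOption (I.graph.weight u v))))

theorem Instance.encode_injective : Function.Injective Instance.encode := by
  rintro ⟨n, G⟩ ⟨m, H⟩ h
  have h1 := Data.ofList_injective h
  have hnm : n = m := by simpa using congrArg List.length h1
  subst hnm
  have h2 := List.ofFn_injective h1
  have h3 : G = H := by
    apply GameGraph.ext
    · funext u
      have := congrFun h2 u
      simp only [Data.pair.injEq] at this
      exact Data.ofBool_injective this.1
    · funext u v
      have := congrFun h2 u
      simp only [Data.pair.injEq] at this
      exact Data.ofOption_injective
        (congrFun (List.ofFn_injective (Data.ofList_injective this.2)) v)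
  rw [h3]

/-- The value problem of energy games on the graphs in the class `C`: compute the minimal
sufficient energy of every node. -/
noncomputable def energyValueProblem (C : Instance → Prop) : Problem where
  Inst := {I : Instance // C I}
  encode I := I.1.encode
  encode_injective := Instance.encode_injective.comp Subtype.val_injective
  answer I := Data.ofList (List.ofFn fun s => Data.ofENat (I.1.graph.minEnergy s))

/-- The value problem of mean-payoff games on the graphs in the class `C`: compute the value of
every node. -/
noncomputable def meanPayoffValueProblem (C : Instance → Prop) : Problem where
  Inst := {I : Instance // C I}
  encode I := I.1.encode
  encode_injective := Instance.encode_injective.comp Subtype.val_injective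
  answer I := Data.ofList (List.ofFn fun s => Data.ofRat (I.1.graph.meanValue s))

/-- The class of all game graphs. -/
def AllGraphs (_ : Instance) : Prop := True

/-- The class of complete bipartite game graphs. -/
def CompleteBipartiteGraphs (I : Instance) : Prop := I.graph.IsCompleteBipartite

end EnergyGames

/-! ### Energy and mean payoff through lower bounds on prefix weights; walks against a fixed
strategy. -/

namespace EnergyGames

/-! A complete bipartite instance is itself a general one, so only the reduction from general graphs
needs an idea. It asks one query for every start node `s`, and the query depends on `s`.

First the graph is made bipartite. Nodes are split so that a move becomes two, one of them carrying
twice the old weight and the other weight zero. Mean payoffs are unchanged and minimal energies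
double (`bipartite_meanValue`, `bipartite_minEnergy_le_iff`). This also supplies a node `d` of Bob
whose only edge leads to `s`.

Then the missing edges between the players are added. With `Z` at least the number of nodes times
the largest absolute weight, a new edge costs Alice `16 Z` if she takes it; if Bob takes it, he
gives her `4 Z` when it leads to `s` and `32 Z` otherwise. The value at `s` does not change, for two
reasons.

Alice gains nothing (`exists_bounded_of_complete`): when she first uses a new edge, Bob returns to a
node already visited, giving back at most `4 Z`. This closes a cycle so negative that her strategy
would be losing.

Bob gains nothing (`exists_bounded_complete`): if he jumps to `s`, the gift refills the energy with
which Alice starts. If he jumps elsewhere, she is rich enough to continue until she can pay for the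
move to `d`, whence Bob must enter `s` or give another gift. Such play revisits nodes with different
energies, so Alice's positional strategy must also withstand arbitrary walks of Bob. It does,
because removing cycles from a walk never raises its lowered weight when all cycles are good
(`Reach.exists_simple`, `Reach.nonneg`).

The predicate `Bounded` treats both games at once: energy `k` suffices when the bound holds with `v
= 0`, and the mean payoff is at least `v` when it holds for some `k`.

For the running time, `PolyComputable` is a closed calculus of polynomial-time computable families
with oracle calls, in which the query is assembled; `nodeValueProblem_equivalent` combines the two
halves. -/

theorem enat_le_of_forall_natCast {x y : ℕ∞} (h : ∀ k : ℕ, y ≤ k → x ≤ k) : x ≤ y := by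
  induction y using ENat.recTopCoe with
  | top => exact le_top
  | coe k => exact h k le_rfl

namespace GameGraph

variable {V : Type}

/-- The weight of an edge (`0` for non-edges). -/
def wt (G : GameGraph V) (u v : V) : ℤ := (G.weight u v).getD 0

theorem pathWeight_zero (G : GameGraph V) (σ : G.Strategy true) (τ : G.Strategy false) (s : V) :
    G.pathWeight σ τ s 0 = 0 := by
  simp [pathWeight]

theorem pathWeight_succ (G : GameGraph V) (σ : G.Strategy true) (τ : G.Strategy false) (s : V)
    (i : ℕ) : G.pathWeight σ τ s (i + 1) =
      G.pathWeight σ τ s i + G.wt ((G.next σ τ)^[i] s) ((G.next σ τ)^[i + 1] s) := by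
  simp [pathWeight, wt, Finset.sum_range_succ]

theorem pathWeight_add (G : GameGraph V) (σ : G.Strategy true) (τ : G.Strategy false) (s : V)
    (a i : ℕ) : G.pathWeight σ τ s (a + i) =
      G.pathWeight σ τ s a + G.pathWeight σ τ ((G.next σ τ)^[a] s) i := by
  induction i with
  | zero => simp [pathWeight_zero]
  | succ i ih =>
    rw [← add_assoc, pathWeight_succ, ih, pathWeight_succ, ← Function.iterate_add_apply,
      ← Function.iterate_add_apply]
    rw [show i + 1 + a = a + i + 1 by ring, show i + a = a + i by ring]
    ring

theorem next_of_alice (G : GameGraph V) (σ : G.Strategy true) (τ : G.Strategy false) {u : V}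
    (h : G.alice u = true) : G.next σ τ u = (σ u h).1 := by
  unfold next
  split
  · rfl
  · rename_i h'; simp [h] at h'

theorem next_of_bob (G : GameGraph V) (σ : G.Strategy true) (τ : G.Strategy false) {u : V}
    (h : G.alice u = false) : G.next σ τ u = (τ u h).1 := by
  unfold next
  split
  · rename_i h'; simp [h] at h'
  · rfl

theorem edge_next (G : GameGraph V) (σ : G.Strategy true) (τ : G.Strategy false) (u : V) :
    G.Edge u (G.next σ τ u) := by
  cases h : G.alice u with
  | true => rw [next_of_alice _ _ _ h]; exact (σ u h).2
  | false => rw [next_of_bob _ _ _ h]; exact (τ u h).2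

/-- The partial sums of the weights, lowered by `v` each, along the play from `s` never drop
below `-k`. -/
def Bounded (G : GameGraph V) (σ : G.Strategy true) (τ : G.Strategy false) (s : V) (v k : ℚ) :
    Prop :=
  ∀ i : ℕ, 0 ≤ k + G.pathWeight σ τ s i - i * v

theorem sustains_iff_bounded (G : GameGraph V) (σ : G.Strategy true) (τ : G.Strategy false)
    (s : V) (k : ℕ) : G.Sustains σ τ s k ↔ G.Bounded σ τ s 0 k := by
  unfold Sustains Bounded
  refine forall_congr' fun i => ?_
  rw [mul_zero, sub_zero]
  exact_mod_cast Iff.rfl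

theorem pathWeight_mul (G : GameGraph V) (σ : G.Strategy true) (τ : G.Strategy false) {c : V}
    {p : ℕ} (hp : (G.next σ τ)^[p] c = c) (m : ℕ) :
    G.pathWeight σ τ c (m * p) = m * G.pathWeight σ τ c p := by
  induction m with
  | zero => simp [pathWeight_zero]
  | succ m ih =>
    have : (G.next σ τ)^[m * p] c = c := by
      rw [mul_comm, Function.iterate_mul]
      exact Function.iterate_fixed hp m
    rw [Nat.succ_mul, pathWeight_add, ih, this]
    push_cast
    ring

/-- The mean weight of a cycle on a bounded play is at least `v`. -/
theorem Bounded.le_cycle {G : GameGraph V} {σ : G.Strategy true} {τ : G.Strategy false} {s : V}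
    {v k : ℚ} (h : G.Bounded σ τ s v k) {a p : ℕ}
    (hp : (G.next σ τ)^[a + p] s = (G.next σ τ)^[a] s) :
    p * v ≤ G.pathWeight σ τ ((G.next σ τ)^[a] s) p := by
  by_contra! hlt
  have hp' : (G.next σ τ)^[p] ((G.next σ τ)^[a] s) = (G.next σ τ)^[a] s := by
    rw [← Function.iterate_add_apply, add_comm, hp]
  obtain ⟨m, hm⟩ := exists_nat_gt ((k + G.pathWeight σ τ s a - a * v) /
    (p * v - G.pathWeight σ τ ((G.next σ τ)^[a] s) p))
  rw [div_lt_iff₀ (by linarith)] at hm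
  have := h (a + m * p)
  rw [pathWeight_add, pathWeight_mul G σ τ hp'] at this
  push_cast at this
  linarith

theorem pathWeight_shift (G : GameGraph V) (σ : G.Strategy true) (τ : G.Strategy false) {c : V}
    {p : ℕ} (hp : (G.next σ τ)^[p] c = c) (i : ℕ) :
    G.pathWeight σ τ ((G.next σ τ)^[i] c) p = G.pathWeight σ τ c p := by
  have h1 := pathWeight_add G σ τ c i p
  rw [add_comm i p, pathWeight_add, hp] at h1
  linarith

theorem Bounded.mono {G : GameGraph V} {σ : G.Strategy true} {τ : G.Strategy false} {s : V}
    {v k k' : ℚ} (h : G.Bounded σ τ s v k) (hk : k ≤ k') : G.Bounded σ τ s v k' := fun i => by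
  have := h i
  linarith

/-- Pigeonhole: two of the first `card V + 1` iterates coincide, so after `card V` steps the orbit
is on its cycle. Hence `playMean` never divides by zero. -/
theorem iterate_card_periodic [Fintype V] (f : V → V) (s : V) :
    0 < Function.minimalPeriod f (f^[Fintype.card V] s) := by
  obtain ⟨a, b, hab, h⟩ : ∃ a b : Fin (Fintype.card V + 1), a < b ∧ f^[a] s = f^[b] s := by
    obtain ⟨a, b, hne, h⟩ := Fintype.exists_ne_map_eq_of_card_lt
      (fun i : Fin (Fintype.card V + 1) => f^[i] s) (by simp)
    rcases lt_or_gt_of_ne hne with hlt | hlt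
    · exact ⟨a, b, hlt, h⟩
    · exact ⟨b, a, hlt, h.symm⟩
  have hab' : (a : ℕ) < b := hab
  have hb : (b : ℕ) ≤ Fintype.card V := Nat.lt_succ_iff.1 b.2
  apply Function.minimalPeriod_pos_of_mem_periodicPts
  refine ⟨b - a, by omega, ?_⟩
  change f^[b - a] _ = _
  rw [← Function.iterate_add_apply,
    show (b : ℕ) - a + Fintype.card V = (Fintype.card V - a) + b by omega,
    Function.iterate_add_apply, ← h, ← Function.iterate_add_apply]
  congr 2
  omega

/-- Each turn around the final cycle adds the same lowered weight. If this is negative, the prefixes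
drift to minus infinity; otherwise the prefixes up to the end of the first turn bound all the
others. -/
theorem le_playMean_iff [Fintype V] (G : GameGraph V) (σ : G.Strategy true)
    (τ : G.Strategy false) (s : V) (v : ℚ) :
    v ≤ G.playMean σ τ s ↔ ∃ k, G.Bounded σ τ s v k := by
  have hpos := iterate_card_periodic (G.next σ τ) s
  have hper : (G.next σ τ)^[Function.minimalPeriod (G.next σ τ)
      ((G.next σ τ)^[Fintype.card V] s)] ((G.next σ τ)^[Fintype.card V] s) =
      (G.next σ τ)^[Fintype.card V] s := Function.iterate_minimalPeriod
  unfold playMean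
  simp only
  generalize hpdef : Function.minimalPeriod (G.next σ τ) ((G.next σ τ)^[Fintype.card V] s) = p
    at hpos hper ⊢
  generalize hN : Fintype.card V = N at hper ⊢
  have hp0 : (0 : ℚ) < p := by exact_mod_cast hpos
  rw [le_div_iff₀ hp0]
  constructor
  · intro hv
    obtain ⟨B, hB⟩ : ∃ B : ℚ, ∀ j < N + p, -B ≤ (G.pathWeight σ τ s j : ℚ) - j * v := by
      refine ⟨∑ j ∈ Finset.range (N + p), |(G.pathWeight σ τ s j : ℚ) - j * v|, fun j hj => ?_⟩
      have := Finset.single_le_sum (f := fun j : ℕ => |(G.pathWeight σ τ s j : ℚ) - j * v|)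
        (fun i _ => abs_nonneg _) (Finset.mem_range.2 hj)
      have h2 := neg_abs_le ((G.pathWeight σ τ s j : ℚ) - j * v)
      linarith
    refine ⟨B, fun i => ?_⟩
    suffices -B ≤ (G.pathWeight σ τ s i : ℚ) - i * v by linarith
    induction i using Nat.strong_induction_on with
    | _ i ih =>
      by_cases hi : i < N + p
      · exact hB i hi
      -- Dropping the last period lowers the prefix by the lowered weight of the cycle, which is
      -- nonnegative.
      · obtain ⟨r, rfl⟩ : ∃ r, i = N + r + p := ⟨i - N - p, by omega⟩
        have h1 := ih (N + r) (by omega)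
        have h2 : (G.next σ τ)^[N + r] s = (G.next σ τ)^[r] ((G.next σ τ)^[N] s) := by
          rw [← Function.iterate_add_apply, add_comm]
        rw [pathWeight_add, h2, pathWeight_shift G σ τ hper]
        push_cast at h1 ⊢
        linarith
  · rintro ⟨k, hk⟩
    have := hk.le_cycle (a := N) (p := p) (by rw [add_comm, Function.iterate_add_apply, hper])
    linarith

/-- There are finitely many strategies, so the infimum is attained and a single `σ` serves against
every `τ`. -/
theorem minEnergy_le_iff [Finite V] (G : GameGraph V) (s : V) (k : ℕ) :
    G.minEnergy s ≤ k ↔ ∃ σ, ∀ τ, G.Bounded σ τ s 0 k := by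
  have hplay : ∀ σ τ, G.playEnergy σ τ s ≤ k ↔ G.Bounded σ τ s 0 k := by
    intro σ τ
    rw [← sustains_iff_bounded]
    unfold playEnergy
    constructor
    · intro h
      by_contra hn
      have : ((k + 1 : ℕ) : ℕ∞) ≤ ⨅ (k : ℕ) (_ : G.Sustains σ τ s k), (k : ℕ∞) := by
        refine le_iInf₂ fun m hm => ?_
        by_contra! hlt
        have hlt' : m < k + 1 := by exact_mod_cast hlt
        apply hn
        intro i
        have := hm i
        have h3 : (m : ℤ) ≤ k := by exact_mod_cast Nat.lt_succ_iff.1 hlt'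
        linarith
      have h4 := this.trans h
      have : k + 1 ≤ k := by exact_mod_cast h4
      omega
    · intro h
      exact iInf₂_le k h
  unfold minEnergy
  obtain ⟨σ₀, hσ₀⟩ := exists_eq_ciInf_of_finite
    (f := fun σ : G.Strategy true => ⨆ τ : G.Strategy false, G.playEnergy σ τ s)
  constructor
  · intro h
    rw [← hσ₀] at h
    exact ⟨σ₀, fun τ => (hplay _ _).1 ((le_iSup _ τ).trans h)⟩
  · rintro ⟨σ, hσ⟩
    exact (iInf_le _ σ).trans (iSup_le fun τ => (hplay _ _).2 (hσ τ))

theorem le_meanValue_iff [Fintype V] (G : GameGraph V) (s : V) (v : ℚ) :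
    v ≤ G.meanValue s ↔ ∃ σ, ∀ τ, ∃ k, G.Bounded σ τ s v k := by
  unfold meanValue
  simp [Finset.le_sup'_iff, Finset.le_inf'_iff, le_playMean_iff]

/-! ### Plays against a fixed strategy of Alice -/

/-- The edges of the graph that remains when Alice has fixed her strategy. -/
def Step (G : GameGraph V) (σ : G.Strategy true) (x y : V) : Prop :=
  G.Edge x y ∧ ∀ h : G.alice x = true, y = (σ x h).1

theorem step_next (G : GameGraph V) (σ : G.Strategy true) (τ : G.Strategy false) (x : V) :
    G.Step σ x (G.next σ τ x) :=
  ⟨G.edge_next σ τ x, fun h => G.next_of_alice σ τ h⟩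

/-- Bob can follow every walk that leaves no node twice. -/
theorem exists_strategy_following (G : GameGraph V) (σ : G.Strategy true) (u : ℕ → V) (m : ℕ)
    (hinj : Set.InjOn u (Set.Iio m)) (hstep : ∀ l < m, G.Step σ (u l) (u (l + 1))) :
    ∃ τ, ∀ l ≤ m, (G.next σ τ)^[l] (u 0) = u l := by
  classical
  let τ : G.Strategy false := fun x hx =>
    if h : ∃ l, l < m ∧ u l = x then
      ⟨u (h.choose + 1), by
        have := hstep _ h.choose_spec.1
        rw [h.choose_spec.2] at this
        exact this.1⟩
    else Classical.arbitrary (G.Strategy false) x hx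
  refine ⟨τ, fun l => ?_⟩
  induction l with
  | zero => intro _; rfl
  | succ l ih =>
    intro hl
    rw [Function.iterate_succ_apply', ih (by omega)]
    cases h : G.alice (u l) with
    | true => rw [next_of_alice _ _ _ h, (hstep l (by omega)).2 h]
    | false =>
      have hex : ∃ l', l' < m ∧ u l' = u l := ⟨l, by omega, rfl⟩
      rw [next_of_bob _ _ _ h]
      simp only [τ, dif_pos hex]
      -- The chosen index is `l` itself because the walk leaves no node twice.
      rw [hinj hex.choose_spec.1 (show l < m by omega) hex.choose_spec.2]

theorem pathWeight_of_following (G : GameGraph V) (σ : G.Strategy true) (τ : G.Strategy false)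
    (u : ℕ → V) (m : ℕ) (h : ∀ l ≤ m, (G.next σ τ)^[l] (u 0) = u l) :
    G.pathWeight σ τ (u 0) m = ∑ l ∈ Finset.range m, G.wt (u l) (u (l + 1)) := by
  unfold pathWeight
  refine Finset.sum_congr rfl fun l hl => ?_
  have hl := Finset.mem_range.1 hl
  rw [h l (by omega), h (l + 1) (by omega)]
  rfl

/-- `G.Reach σ s v k x r`: a walk that is consistent with `σ` leads from `s` to `x`, and it changes
the energy `k` to `r` if the weight of every edge is lowered by `v`. -/
inductive Reach (G : GameGraph V) (σ : G.Strategy true) (s : V) (v k : ℚ) : V → ℚ → Prop where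
  | refl : Reach G σ s v k s k
  | step {x y : V} {r : ℚ} : Reach G σ s v k x r → G.Step σ x y →
      Reach G σ s v k y (r + G.wt x y - v)

theorem reach_iterate (G : GameGraph V) (σ : G.Strategy true) (τ : G.Strategy false) (s : V)
    (v k : ℚ) (i : ℕ) :
    G.Reach σ s v k ((G.next σ τ)^[i] s) (k + G.pathWeight σ τ s i - i * v) := by
  induction i with
  | zero => simpa [pathWeight_zero] using Reach.refl
  | succ i ih =>
    have := ih.step (step_next G σ τ _)
    rw [pathWeight_succ, Function.iterate_succ_apply']
    convert this using 1
    push_cast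
    ring

/-- If Alice's strategy leaves no cycle of mean weight below `v`, then every walk can be replaced
by a simple path that is at most as heavy. -/
theorem Reach.exists_simple {G : GameGraph V} {σ : G.Strategy true} {s : V} {v k : ℚ}
    (hσ : ∀ τ, ∃ k, G.Bounded σ τ s v k) {x : V} {r : ℚ} (h : G.Reach σ s v k x r) :
    ∃ (u : ℕ → V) (j : ℕ), u 0 = s ∧ u j = x ∧ Set.InjOn u (Set.Iic j) ∧
      (∀ l < j, G.Step σ (u l) (u (l + 1))) ∧
      k + ((∑ l ∈ Finset.range j, G.wt (u l) (u (l + 1)) : ℤ) : ℚ) - j * v ≤ r := by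
  induction h with
  | refl => exact ⟨fun _ => s, 0, rfl, rfl, by
      intro a ha b hb _; rw [Nat.le_zero.1 ha, Nat.le_zero.1 hb], by simp, by simp⟩
  | @step x y r _ hxy ih =>
    obtain ⟨u, j, h0, hj, hinj, hst, hsum⟩ := ih
    -- The simple path to `x` extended by `y`. Its first `j + 1` nodes are distinct; only the last
    -- may close a cycle.
    let u' : ℕ → V := Function.update u (j + 1) y
    have hu' : ∀ l ≤ j, u' l = u l := fun l hl => Function.update_of_ne (by omega) _ _
    have hu'j : u' (j + 1) = y := Function.update_self _ _ _
    have hst' : ∀ l < j + 1, G.Step σ (u' l) (u' (l + 1)) := by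
      intro l hl
      rcases Nat.lt_succ_iff_lt_or_eq.1 hl with h | rfl
      · rw [hu' l (by omega), hu' (l + 1) (by omega)]; exact hst l h
      · rw [hu' l le_rfl, hu'j, hj]; exact hxy
    have hsum' : ∑ l ∈ Finset.range j, G.wt (u' l) (u' (l + 1)) =
        ∑ l ∈ Finset.range j, G.wt (u l) (u (l + 1)) := by
      refine Finset.sum_congr rfl fun l hl => ?_
      have := Finset.mem_range.1 hl
      rw [hu' l (by omega), hu' (l + 1) (by omega)]
    by_cases hy : ∃ i ≤ j, u i = y
    · obtain ⟨i, hij, hi⟩ := hy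
      refine ⟨u, i, h0, hi, hinj.mono (Set.Iic_subset_Iic.2 hij), fun l hl => hst l (by omega), ?_⟩
      -- A positional strategy of Bob runs into the cycle from `u i` to `y`, so its lowered weight
      -- is nonnegative and it can be cut off.
      obtain ⟨τ, hτ⟩ := G.exists_strategy_following σ u' (j + 1) (by
        intro a ha b hb hab
        have ha' : a ≤ j := Nat.lt_succ_iff.1 ha
        have hb' : b ≤ j := Nat.lt_succ_iff.1 hb
        rw [hu' a ha', hu' b hb'] at hab
        exact hinj ha' hb' hab) hst'
      obtain ⟨k', hk'⟩ := hσ τ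
      have hu0 : u' 0 = s := by rw [hu' 0 (by omega), h0]
      have hpi := G.pathWeight_of_following σ τ u' i (fun l hl => hτ l (by omega))
      have hpj := G.pathWeight_of_following σ τ u' (j + 1) hτ
      have hcyc := hk'.le_cycle (a := i) (p := j + 1 - i) (by
        rw [← hu0, show i + (j + 1 - i) = j + 1 by omega, hτ _ le_rfl, hτ i (by omega), hu'j,
          hu' i hij, hi])
      have hadd := G.pathWeight_add σ τ s i (j + 1 - i)
      rw [show i + (j + 1 - i) = j + 1 by omega, ← hu0, hpi, hpj, Finset.sum_range_succ, hsum',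
        hu'j, hu' j le_rfl, hj] at hadd
      rw [← hu0] at hcyc
      have hcast : ((j + 1 - i : ℕ) : ℚ) = j + 1 - i := by
        rw [Nat.cast_sub (by omega)]; push_cast; ring
      rw [hcast] at hcyc
      have hsumi : ∑ l ∈ Finset.range i, G.wt (u' l) (u' (l + 1)) =
          ∑ l ∈ Finset.range i, G.wt (u l) (u (l + 1)) := by
        refine Finset.sum_congr rfl fun l hl => ?_
        have := Finset.mem_range.1 hl
        rw [hu' l (by omega), hu' (l + 1) (by omega)]
      rw [hsumi] at hadd
      have hadd' := congrArg (Int.cast : ℤ → ℚ) hadd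
      rw [Int.cast_add, Int.cast_add] at hadd'
      linarith
    · push Not at hy
      refine ⟨u', j + 1, by rw [hu' 0 (by omega), h0], hu'j, ?_, hst', ?_⟩
      · intro a ha b hb hab
        have ha : a ≤ j + 1 := ha
        have hb : b ≤ j + 1 := hb
        rcases Nat.le_succ_iff.1 ha with ha' | rfl <;> rcases Nat.le_succ_iff.1 hb with hb' | rfl
        · rw [hu' a ha', hu' b hb'] at hab
          exact hinj ha' hb' hab
        · rw [hu' a ha', hu'j] at hab
          exact absurd hab (hy a ha')
        · rw [hu' b hb', hu'j] at hab
          exact absurd hab.symm (hy b hb')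
        · rfl
      · rw [Finset.sum_range_succ, hsum', hu'j, hu' j le_rfl, hj]
        push_cast at hsum ⊢
        linarith

/-- If Bob cannot exhaust the energy `k` with a positional strategy, then he cannot do so at
all. -/
theorem Reach.nonneg {G : GameGraph V} {σ : G.Strategy true} {s : V} {v k : ℚ}
    (hσ : ∀ τ, G.Bounded σ τ s v k) {x : V} {r : ℚ} (h : G.Reach σ s v k x r) : 0 ≤ r := by
  obtain ⟨u, j, rfl, -, hinj, hst, hsum⟩ := h.exists_simple fun τ => ⟨k, hσ τ⟩
  obtain ⟨τ, hτ⟩ := G.exists_strategy_following σ u j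
    (hinj.mono fun a (ha : a < j) => ha.le) hst
  have := hσ τ j
  rw [pathWeight_of_following G σ τ u j hτ] at this
  linarith

/-- A play without cycles of mean weight below `v` needs no more energy than a simple path. -/
theorem bounded_of_exists_bounded [Fintype V] {G : GameGraph V} {W : ℚ}
    (hW : ∀ x y, |(G.wt x y : ℚ)| ≤ W) {σ : G.Strategy true} {s : V} {v : ℚ} (hv : |v| ≤ W)
    (hσ : ∀ τ, ∃ k, G.Bounded σ τ s v k) (τ : G.Strategy false) :
    G.Bounded σ τ s v (Fintype.card V * (2 * W)) := by
  intro i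
  obtain ⟨u, j, -, -, hinj, -, hsum⟩ :=
    (G.reach_iterate σ τ s v (Fintype.card V * (2 * W)) i).exists_simple hσ
  refine le_trans ?_ hsum
  have hj : j ≤ Fintype.card V := by
    have := Finset.card_le_card_of_injOn (s := Finset.Iic j) (t := Finset.univ) u (by simp)
      (by simpa using hinj)
    simp at this
    omega
  have h1 : -(j * (2 * W)) ≤
      ((∑ l ∈ Finset.range j, G.wt (u l) (u (l + 1)) : ℤ) : ℚ) - j * v := by
    have h2 : (∑ l ∈ Finset.range j, (-W) : ℚ) ≤
        ∑ l ∈ Finset.range j, (G.wt (u l) (u (l + 1)) : ℚ) :=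
      Finset.sum_le_sum fun l _ => (abs_le.1 (hW _ _)).1
    rw [Finset.sum_const, Finset.card_range, nsmul_eq_mul] at h2
    have h3 := mul_le_mul_of_nonneg_left (abs_le.1 hv).2 (Nat.cast_nonneg (α := ℚ) j)
    push_cast
    linarith
  have hW0 : 0 ≤ W := (abs_nonneg v).trans hv
  have h4 : (j : ℚ) * (2 * W) ≤ Fintype.card V * (2 * W) := by
    have : (j : ℚ) ≤ Fintype.card V := by exact_mod_cast hj
    gcongr
  linarith

theorem abs_pathWeight_le (G : GameGraph V) {W : ℚ} (hW : ∀ x y, |(G.wt x y : ℚ)| ≤ W)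
    (σ : G.Strategy true) (τ : G.Strategy false) (s : V) (i : ℕ) :
    |(G.pathWeight σ τ s i : ℚ)| ≤ i * W := by
  induction i with
  | zero => simp [pathWeight_zero]
  | succ i ih =>
    rw [pathWeight_succ]
    push_cast
    have := hW ((G.next σ τ)^[i] s) ((G.next σ τ)^[i + 1] s)
    exact (abs_add_le _ _).trans (by linarith)

/-- Maximum and minimum are attained, so the value is the mean weight of one cycle of at most `card
V` edges. This bounds the value and the bit length of its numerator and denominator. -/
theorem exists_meanValue_eq_div [Fintype V] (G : GameGraph V) {W : ℚ}
    (hW : ∀ x y, |(G.wt x y : ℚ)| ≤ W) (s : V) :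
    ∃ (a : ℤ) (p : ℕ), 0 < p ∧ p ≤ Fintype.card V ∧ |(a : ℚ)| ≤ p * W ∧
      G.meanValue s = a / p := by
  unfold meanValue
  let := Fintype.ofFinite (G.Strategy true)
  let := Fintype.ofFinite (G.Strategy false)
  obtain ⟨σ, -, h⟩ := Finset.exists_mem_eq_sup' (s := Finset.univ) Finset.univ_nonempty
    fun σ : G.Strategy true =>
      Finset.univ.inf' Finset.univ_nonempty fun τ : G.Strategy false => G.playMean σ τ s
  obtain ⟨τ, -, h'⟩ := Finset.exists_mem_eq_inf' (s := Finset.univ) Finset.univ_nonempty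
    fun τ : G.Strategy false => G.playMean σ τ s
  rw [h, h']
  refine ⟨_, _, iterate_card_periodic (G.next σ τ) s, ?_, G.abs_pathWeight_le hW σ τ _ _, rfl⟩
  exact Function.minimalPeriod_le_card

theorem abs_meanValue_le [Fintype V] (G : GameGraph V) {W : ℚ}
    (hW : ∀ x y, |(G.wt x y : ℚ)| ≤ W) (s : V) : |G.meanValue s| ≤ W := by
  obtain ⟨a, p, hp, -, ha, h⟩ := G.exists_meanValue_eq_div hW s
  have hp' : (0 : ℚ) < p := by exact_mod_cast hp
  rw [h, abs_div, abs_of_pos hp', div_le_iff₀ hp', mul_comm]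
  exact ha

/-- A finite minimal energy never exceeds what a simple path can consume; this keeps the oracle's
answers polynomially short. -/
theorem minEnergy_le [Fintype V] (G : GameGraph V) {W : ℕ}
    (hW : ∀ x y, |(G.wt x y : ℚ)| ≤ W) {s : V} (h : G.minEnergy s ≠ ⊤) :
    G.minEnergy s ≤ (Fintype.card V * (2 * W) : ℕ) := by
  obtain ⟨k, hk⟩ := ENat.ne_top_iff_exists.1 h
  obtain ⟨σ, hσ⟩ := (G.minEnergy_le_iff s k).1 hk.ge
  rw [minEnergy_le_iff]
  refine ⟨σ, fun τ => ?_⟩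
  have := bounded_of_exists_bounded hW (v := 0) (by simp) (fun τ => ⟨_, hσ τ⟩) τ
  exact_mod_cast this

end GameGraph

end EnergyGames

/-! ### Adding the missing edges without changing the value at `s`. -/

namespace EnergyGames

namespace GameGraph

variable {V : Type}

/-- The completion of a bipartite game graph. Moving along a new edge is very costly for Alice.
For Bob it is costly too, but much less so if the edge leads to the node `s`. -/
def complete [DecidableEq V] (G : GameGraph V) (s d : V) (hs : G.alice s = true)
    (hd : G.alice d = false) (Z : ℤ) : GameGraph V where
  alice := G.alice
  weight x y := if G.alice x = G.alice y then none else
    some ((G.weight x y).getD (if G.alice x = true then -16 * Z else if y = s then 4 * Z else 32 * Z))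
  exists_edge x := by
    cases h : G.alice x with
    | true => exact ⟨d, by simp [hd]⟩
    | false => exact ⟨s, by simp [hs]⟩

section Complete

variable [DecidableEq V] {G : GameGraph V} {s d : V} {hs : G.alice s = true}
  {hd : G.alice d = false} {Z : ℤ}

theorem complete_edge_iff {x y : V} :
    (G.complete s d hs hd Z).Edge x y ↔ G.alice x ≠ G.alice y := by
  by_cases h : G.alice x = G.alice y <;> simp [Edge, complete, h]

theorem complete_isCompleteBipartite : (G.complete s d hs hd Z).IsCompleteBipartite :=
  ⟨fun _ _ h he => complete_edge_iff.1 he h, fun _ _ h => complete_edge_iff.2 h⟩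

theorem complete_wt_of_edge (hb : ∀ x y, G.Edge x y → G.alice x ≠ G.alice y) {x y : V}
    (h : G.Edge x y) : (G.complete s d hs hd Z).wt x y = G.wt x y := by
  obtain ⟨w, hw⟩ := Option.isSome_iff_exists.1 h
  simp [wt, complete, hb x y h, hw]

theorem complete_wt_of_not_edge {x y : V} (h : ¬ G.Edge x y) (hxy : G.alice x ≠ G.alice y) :
    (G.complete s d hs hd Z).wt x y =
      if G.alice x = true then -16 * Z else if y = s then 4 * Z else 32 * Z := by
  have hw : G.weight x y = none := by simpa [Edge] using h
  simp [wt, complete, hxy, hw]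

open Classical in
/-- Alice keeps to a good strategy where this is affordable, and otherwise moves to `d`. -/
theorem exists_bounded_complete [Fintype V] (hb : ∀ x y, G.Edge x y → G.alice x ≠ G.alice y)
    (hds : ∀ y, G.Edge d y → y = s) {W : ℚ} (hW : ∀ x y, |(G.wt x y : ℚ)| ≤ W) (hW1 : 1 ≤ W)
    (hZ : Fintype.card V * W ≤ Z) {v k : ℚ} (hv : |v| ≤ W) (hk : k ≤ Fintype.card V * (2 * W))
    {σ : G.Strategy true} (hσ : ∀ τ, G.Bounded σ τ s v k) :
    ∃ σ', ∀ τ', (G.complete s d hs hd Z).Bounded σ' τ' s v k := by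
  have hcard : (1 : ℚ) ≤ Fintype.card V := by
    exact_mod_cast Nat.one_le_iff_ne_zero.2 (Fintype.card_pos_iff.2 ⟨s⟩).ne'
  have hWZ : W ≤ Z := by nlinarith
  have hk2 : k ≤ 2 * Z := by linarith
  have hk0 : 0 ≤ k := Reach.nonneg hσ Reach.refl
  obtain ⟨hv1, hv2⟩ := abs_le.1 hv
  -- Enough to pay `16 Z` and one lowering by `v ≤ W` for the move to `d`, and still have `k + 2 W`
  -- there. The move from `d` to `s` costs at most `2 W`, so the play restarts at `s` with `k`.
  set C : ℚ := 16 * Z + k + 3 * W with hC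
  let cap : V → ℚ := fun x => if x = d then k + 2 * W else if G.alice x = true then C else C + 2 * W
  -- Invariant of the play: Alice has at least the energy of some walk consistent with `σ`, or she
  -- has a reserve sufficient to get back to `s`.
  let Good : V → ℚ → Prop := fun x t => (∃ r ≤ t, G.Reach σ s v k x r) ∨ cap x ≤ t
  have hcap_alice : ∀ x, G.alice x = true → cap x = C := by
    intro x hx
    have : x ≠ d := by rintro rfl; simp [hd] at hx
    simp [cap, this, hx]
  have hgood_nonneg : ∀ x t, Good x t → 0 ≤ t := by
    rintro x t (⟨r, hr, h⟩ | h)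
    · exact (Reach.nonneg hσ h).trans hr
    · refine le_trans ?_ h
      simp only [cap]
      split_ifs <;> linarith
  -- The choice may depend on `x` only, not on the energy. If a walk reaches `x` with less than `C`,
  -- then `σ` is safe under either half of `Good`; if not, either half gives at least `C`, so the
  -- move to `d` is affordable.
  let σ' : (G.complete s d hs hd Z).Strategy true := fun x hx =>
    if ∃ r < C, G.Reach σ s v k x r then
      ⟨(σ x hx).1, complete_edge_iff.2 (hb _ _ (σ x hx).2)⟩
    else ⟨d, complete_edge_iff.2 (by have : G.alice x = true := hx; simp [this, hd])⟩
  refine ⟨σ', fun τ' => ?_⟩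
  suffices H : ∀ i, Good (((G.complete s d hs hd Z).next σ' τ')^[i] s)
      (k + (G.complete s d hs hd Z).pathWeight σ' τ' s i - i * v) from
    fun i => hgood_nonneg _ _ (H i)
  intro i
  induction i with
  | zero => exact Or.inl ⟨k, by simp [pathWeight_zero], Reach.refl⟩
  | succ i ih =>
    rw [pathWeight_succ, Function.iterate_succ_apply']
    generalize ((G.complete s d hs hd Z).next σ' τ')^[i] s = x at ih ⊢
    generalize ((G.complete s d hs hd Z).pathWeight σ' τ' s i) = S at ih ⊢
    push_cast
    rw [show k + (S + ((G.complete s d hs hd Z).wt x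
        ((G.complete s d hs hd Z).next σ' τ' x) : ℚ)) - (i + 1) * v =
      (k + S - i * v) + (G.complete s d hs hd Z).wt x
        ((G.complete s d hs hd Z).next σ' τ' x) - v by ring]
    generalize k + (S : ℚ) - i * v = t at ih ⊢
    have ht := hgood_nonneg _ _ ih
    cases hx : G.alice x with
    | true =>
      rw [next_of_alice (G.complete s d hs hd Z) σ' τ' (u := x) hx]
      by_cases hex : ∃ r < C, G.Reach σ s v k x r
      · simp only [σ', if_pos hex]
        rw [complete_wt_of_edge hb (σ x hx).2]
        obtain ⟨r, hr, hreach⟩ : ∃ r ≤ t, G.Reach σ s v k x r := by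
          rcases ih with h | h
          · exact h
          · obtain ⟨r, hr, hreach⟩ := hex
            rw [hcap_alice x hx] at h
            exact ⟨r, by linarith, hreach⟩
        exact Or.inl ⟨_, by linarith, hreach.step
          ⟨(σ x hx).2, fun _ => rfl⟩⟩
      · simp only [σ', if_neg hex]
        have htC : C ≤ t := by
          rcases ih with ⟨r, hr, hreach⟩ | h
          · push Not at hex
            by_contra! hlt
            exact hex r (by linarith) hreach
          · rwa [hcap_alice x hx] at h
        right
        have hcapd : cap d = k + 2 * W := by simp [cap]
        have hwt : -16 * (Z : ℚ) ≤ (G.complete s d hs hd Z).wt x d := by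
          by_cases he : G.Edge x d
          · rw [complete_wt_of_edge hb he]
            have := (abs_le.1 (hW x d)).1
            linarith
          · rw [complete_wt_of_not_edge he (by simp [hx, hd])]
            simp [hx]
        rw [hcapd]
        linarith
    | false =>
      generalize hy : (G.complete s d hs hd Z).next σ' τ' x = y
      have hedge := (G.complete s d hs hd Z).edge_next σ' τ' x
      rw [hy, complete_edge_iff, hx] at hedge
      have hya : G.alice y = true := by simpa using hedge.symm
      by_cases he : G.Edge x y
      · rw [complete_wt_of_edge hb he]
        rcases ih with ⟨r, hr, hreach⟩ | h
        · exact Or.inl ⟨_, by linarith, hreach.step ⟨he, fun h => by simp [hx] at h⟩⟩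
        · have := (abs_le.1 (hW x y)).1
          by_cases hxd : x = d
          · subst hxd
            rw [hds y he]
            have hcapd : cap x = k + 2 * W := by simp [cap]
            rw [hds y he] at this
            exact Or.inl ⟨k, by linarith, Reach.refl⟩
          · have hcapx : cap x = C + 2 * W := by simp [cap, hxd, hx]
            right
            rw [hcap_alice y hya]
            linarith
      · rw [complete_wt_of_not_edge he (by simp [hx, hya])]
        -- Since `k ≤ 2 Z` and `W ≤ Z`, the gift `4 Z` restores `k` at `s`, and the gift `32 Z`
        -- exceeds `C + W` at any other node.
        by_cases hys : y = s
        · subst hys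
          refine Or.inl ⟨k, ?_, Reach.refl⟩
          simp [hx]
          linarith
        · right
          rw [hcap_alice y hya]
          simp [hx, hys]
          linarith

-- Up to the first visit the orbit has no repetition, since a repetition would allow an earlier
-- visit.
omit [DecidableEq V] in
theorem exists_lt_card_iterate [Fintype V] (f : V → V) (s : V) (P : V → Prop)
    (h : ∃ i, P (f^[i] s)) :
    ∃ i < Fintype.card V, P (f^[i] s) ∧ ∀ j < i, ¬ P (f^[j] s) := by
  classical
  have hspec := Nat.find_spec h
  have hmin := fun j => Nat.find_min h (m := j)
  generalize Nat.find h = i at hspec hmin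
  have hinj : Set.InjOn (fun j => f^[j] s) (Set.Iic i) := by
    have key : ∀ a b, a < b → b ≤ i → f^[a] s ≠ f^[b] s := by
      intro a b hab hbi heq
      apply hmin (i - b + a) (by omega)
      rw [Function.iterate_add_apply, heq, ← Function.iterate_add_apply,
        show i - b + b = i by omega]
      exact hspec
    intro a ha b hb hab
    rcases lt_trichotomy a b with h | h | h
    · exact absurd hab (key a b h hb)
    · exact h
    · exact absurd hab.symm (key b a h ha)
  refine ⟨i, ?_, hspec, fun j hj => hmin j hj⟩
  have := Finset.card_le_card_of_injOn (s := Finset.Iic i) (t := Finset.univ)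
    (fun j => f^[j] s) (by simp) (by simpa using hinj)
  simp at this
  omega

open Classical in
/-- Bob punishes every new edge that Alice uses by returning to a previous node. -/
theorem exists_bounded_of_complete [Fintype V] (hb : ∀ x y, G.Edge x y → G.alice x ≠ G.alice y)
    {W : ℚ} (hW : ∀ x y, |(G.wt x y : ℚ)| ≤ W) (hW1 : 1 ≤ W)
    (hZ : Fintype.card V * W ≤ Z) {v : ℚ} (hv : |v| ≤ W)
    {σ' : (G.complete s d hs hd Z).Strategy true}
    (hσ' : ∀ τ', ∃ k, (G.complete s d hs hd Z).Bounded σ' τ' s v k) :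
    ∃ σ : G.Strategy true, ∀ τ : G.Strategy false,
      ∃ τ', ∀ k, (G.complete s d hs hd Z).Bounded σ' τ' s v k → G.Bounded σ τ s v k := by
  have hcard : (1 : ℚ) ≤ Fintype.card V := by
    exact_mod_cast Nat.one_le_iff_ne_zero.2 (Fintype.card_pos_iff.2 ⟨s⟩).ne'
  have hWZ : W ≤ Z := by nlinarith
  obtain ⟨hv1, hv2⟩ := abs_le.1 hv
  let σ : G.Strategy true := fun x hx =>
    if h : G.Edge x (σ' x hx).1 then ⟨(σ' x hx).1, h⟩
    else Classical.arbitrary (G.Strategy true) x hx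
  refine ⟨σ, fun τ => ?_⟩
  -- The nodes where `σ'` uses a new edge. There `σ` is arbitrary, which is harmless once no play
  -- from `s` reaches them.
  let P : V → Prop := fun x => ∃ hx : G.alice x = true, ¬ G.Edge x (σ' x hx).1
  by_cases hP : ∃ i, P ((G.next σ τ)^[i] s)
  · exfalso
    obtain ⟨i, hin, ⟨hxi, hjump⟩, hmin⟩ := exists_lt_card_iterate _ s P hP
    let u : ℕ → V := fun j => (G.next σ τ)^[j] s
    have hu : ∀ j, (G.next σ τ)^[j] s = u j := fun j => rfl
    rw [hu] at hxi
    have hus : ∀ j, u (j + 1) = G.next σ τ (u j) := fun j => Function.iterate_succ_apply' _ _ _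
    -- On the path to the first jump Bob keeps to `τ`; everywhere else he goes to `s`. Whichever
    -- node `b` the jump leads to, his next move hits the path again.
    let τ' : (G.complete s d hs hd Z).Strategy false := fun y hy =>
      if ∃ j < i, u j = y then ⟨(τ y hy).1, complete_edge_iff.2 (hb _ _ (τ y hy).2)⟩
      else ⟨s, complete_edge_iff.2 (by have : G.alice y = false := hy; simp [this, hs])⟩
    have hnext : ∀ j < i, (G.complete s d hs hd Z).next σ' τ' (u j) = u (j + 1) := by
      intro j hj
      rw [hus]
      cases ha : G.alice (u j) with
      | true =>
        rw [next_of_alice G σ τ ha, next_of_alice (G.complete s d hs hd Z) σ' τ' (u := u j) ha]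
        have := hmin j hj
        simp only [P, not_exists, not_not] at this
        have hedge : G.Edge (u j) (σ' (u j) ha).1 := this ha
        simp only [σ, dif_pos hedge]
      | false =>
        rw [next_of_bob G σ τ ha, next_of_bob (G.complete s d hs hd Z) σ' τ' (u := u j) ha]
        simp only [τ', if_pos (⟨j, hj, rfl⟩ : ∃ j' < i, u j' = u j)]
    have hiter : ∀ j ≤ i, ((G.complete s d hs hd Z).next σ' τ')^[j] s = u j := by
      intro j
      induction j with
      | zero => intro _; rfl
      | succ j ih => intro hj; rw [Function.iterate_succ_apply', ih (by omega), hnext j (by omega)]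
    have hnexti := next_of_alice (G.complete s d hs hd Z) σ' τ' hxi
    generalize hbdef : (σ' (u i) hxi).1 = b at hnexti
    have hjump' : ¬ G.Edge (u i) b := hbdef ▸ hjump
    have hba : G.alice b = false := by
      have := complete_edge_iff.1 (σ' (u i) hxi).2
      rw [hbdef, hxi] at this
      simpa using this.symm
    obtain ⟨k', hk'⟩ := hσ' τ'
    have hwj : ((G.complete s d hs hd Z).wt (u i) b : ℚ) = -16 * Z := by
      rw [complete_wt_of_not_edge hjump' (by simp [hxi, hba])]
      simp [hxi]
    have hseg : ∀ j n, j ≤ n → n ≤ i → ((G.complete s d hs hd Z).pathWeight σ' τ' s n : ℚ) ≤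
        (G.complete s d hs hd Z).pathWeight σ' τ' s j + (n - j) * W := by
      intro j n hjn
      induction n, hjn using Nat.le_induction with
      | base => intro _; simp
      | succ n hjn ih =>
        intro hni
        have he : G.Edge (u n) (u (n + 1)) := hus n ▸ G.edge_next σ τ (u n)
        rw [pathWeight_succ, hiter n (by omega), hiter (n + 1) hni, complete_wt_of_edge hb he]
        have := ih (by omega)
        have := (abs_le.1 (hW (u n) (u (n + 1)))).2
        push_cast
        linarith
    obtain ⟨j, hj, hbj, hwb⟩ : ∃ j ≤ i, (G.complete s d hs hd Z).next σ' τ' b = u j ∧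
        ((G.complete s d hs hd Z).wt b (u j) : ℚ) ≤ 4 * Z := by
      by_cases hex : ∃ j < i, u j = b
      · obtain ⟨j, hj, rfl⟩ := hex
        refine ⟨j + 1, hj, hnext j hj, ?_⟩
        rw [complete_wt_of_edge hb (hus j ▸ G.edge_next σ τ (u j))]
        have := (abs_le.1 (hW (u j) (u (j + 1)))).2
        linarith
      · refine ⟨0, Nat.zero_le _, ?_, ?_⟩
        · rw [next_of_bob (G.complete s d hs hd Z) σ' τ' (u := b) hba]
          simp only [τ', if_neg hex]
          rfl
        · by_cases he : G.Edge b (u 0)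
          · rw [complete_wt_of_edge hb he]
            have := (abs_le.1 (hW b (u 0))).2
            linarith
          · rw [complete_wt_of_not_edge he (by simp [hba, u, hs])]
            simp [hba, u]
    have hi1 : ((G.complete s d hs hd Z).next σ' τ')^[i + 1] s = b := by
      rw [Function.iterate_succ_apply', hiter i le_rfl, hnexti]
    have hi2 : ((G.complete s d hs hd Z).next σ' τ')^[i + 2] s = u j := by
      rw [Function.iterate_succ_apply', hi1, hbj]
    have hcyc := hk'.le_cycle (a := j) (p := i + 2 - j) (by
      rw [show j + (i + 2 - j) = i + 2 by omega, hi2, hiter j hj])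
    have hadd := (G.complete s d hs hd Z).pathWeight_add σ' τ' s j (i + 2 - j)
    rw [show j + (i + 2 - j) = i + 1 + 1 by omega, pathWeight_succ, pathWeight_succ, hi2, hi1,
      hiter i le_rfl] at hadd
    have hadd' := congrArg (Int.cast : ℤ → ℚ) hadd
    push_cast at hadd'
    rw [hwj] at hadd'
    rw [Nat.cast_sub (by omega)] at hcyc
    push_cast at hcyc
    have hs1 := hseg j i hj le_rfl
    have hin' : (i : ℚ) + 1 ≤ Fintype.card V := by exact_mod_cast hin
    have hj0 : (0 : ℚ) ≤ j := Nat.cast_nonneg j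
    have hji : (j : ℚ) ≤ i := by exact_mod_cast hj
    -- The cycle has weight at most `-16 Z + 4 Z + (i - j) W`. As `(i + 1) W ≤ Z`, this is less than
    -- `-(i + 2 - j) W`, so its mean is below `v`.
    have h1 : -((i + 2 - j : ℚ) * W) ≤ (i + 2 - j) * v := by nlinarith
    have h2 : (i : ℚ) * W + W ≤ Z := by nlinarith
    have h3 : 0 ≤ (j : ℚ) * W := by positivity
    linarith
  · push Not at hP
    let τ' : (G.complete s d hs hd Z).Strategy false := fun y hy =>
      ⟨(τ y hy).1, complete_edge_iff.2 (hb _ _ (τ y hy).2)⟩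
    refine ⟨τ', fun k hk => ?_⟩
    have hiter : ∀ j, ((G.complete s d hs hd Z).next σ' τ')^[j] s = (G.next σ τ)^[j] s := by
      intro j
      induction j with
      | zero => rfl
      | succ j ih =>
        rw [Function.iterate_succ_apply', ih, Function.iterate_succ_apply']
        have hj := hP j
        generalize (G.next σ τ)^[j] s = x at hj
        cases ha : G.alice x with
        | true =>
          rw [next_of_alice G σ τ ha, next_of_alice (G.complete s d hs hd Z) σ' τ' (u := x) ha]
          simp only [P, not_exists, not_not] at hj
          simp only [σ, dif_pos (hj ha)]
        | false =>
          rw [next_of_bob G σ τ ha, next_of_bob (G.complete s d hs hd Z) σ' τ' (u := x) ha]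
    have hpw : ∀ j, (G.complete s d hs hd Z).pathWeight σ' τ' s j = G.pathWeight σ τ s j := by
      intro j
      induction j with
      | zero => simp [pathWeight_zero]
      | succ j ih =>
        rw [pathWeight_succ, pathWeight_succ, ih, hiter, hiter, complete_wt_of_edge hb]
        rw [Function.iterate_succ_apply']
        exact G.edge_next σ τ _
    intro i
    rw [← hpw]
    exact hk i

theorem complete_minEnergy [Fintype V] (hb : ∀ x y, G.Edge x y → G.alice x ≠ G.alice y)
    (hds : ∀ y, G.Edge d y → y = s) {W : ℚ} (hW : ∀ x y, |(G.wt x y : ℚ)| ≤ W) (hW1 : 1 ≤ W)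
    (hZ : Fintype.card V * W ≤ Z) :
    (G.complete s d hs hd Z).minEnergy s = G.minEnergy s := by
  have hW0 : |(0 : ℚ)| ≤ W := by rw [abs_zero]; linarith
  refine le_antisymm (enat_le_of_forall_natCast fun k => ?_)
    (enat_le_of_forall_natCast fun k => ?_) <;> rw [minEnergy_le_iff, minEnergy_le_iff]
  rotate_left
  · rintro ⟨σ', hσ'⟩
    obtain ⟨σ, hσ⟩ := exists_bounded_of_complete hb hW hW1 hZ hW0 fun τ' => ⟨_, hσ' τ'⟩
    refine ⟨σ, fun τ => ?_⟩
    obtain ⟨τ', h⟩ := hσ τ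
    exact h _ (hσ' τ')
  · rintro ⟨σ, hσ⟩
    -- The gifts are calibrated to `Z` and refill only a bounded starting energy, so `k` is first
    -- cut down to what simple paths need.
    have hσ2 : ∀ τ, G.Bounded σ τ s 0 (min k (Fintype.card V * (2 * W))) := by
      intro τ
      rcases min_choice (k : ℚ) (Fintype.card V * (2 * W)) with h | h <;> rw [h]
      · exact hσ τ
      · exact bounded_of_exists_bounded hW hW0 (fun τ => ⟨_, hσ τ⟩) τ
    obtain ⟨σ', h⟩ := exists_bounded_complete (hs := hs) (hd := hd) hb hds hW hW1 hZ hW0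
      (min_le_right _ _) hσ2
    exact ⟨σ', fun τ' => (h τ').mono (min_le_left _ _)⟩

theorem complete_meanValue [Fintype V] (hb : ∀ x y, G.Edge x y → G.alice x ≠ G.alice y)
    (hds : ∀ y, G.Edge d y → y = s) {W : ℚ} (hW : ∀ x y, |(G.wt x y : ℚ)| + 1 ≤ W)
    (hZ : Fintype.card V * W ≤ Z) :
    (G.complete s d hs hd Z).meanValue s = G.meanValue s := by
  have hW' : ∀ x y, |(G.wt x y : ℚ)| ≤ W := fun x y => by linarith [hW x y]
  have hW1 : 1 ≤ W := by linarith [hW s s, abs_nonneg (G.wt s s : ℚ)]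
  have key : ∀ v, |v| ≤ W → (v ≤ (G.complete s d hs hd Z).meanValue s ↔ v ≤ G.meanValue s) := by
    intro v hv
    rw [le_meanValue_iff, le_meanValue_iff]
    constructor
    · rintro ⟨σ', hσ'⟩
      obtain ⟨σ, hσ⟩ := exists_bounded_of_complete hb hW' hW1 hZ hv hσ'
      refine ⟨σ, fun τ => ?_⟩
      obtain ⟨τ', h⟩ := hσ τ
      obtain ⟨k, hk⟩ := hσ' τ'
      exact ⟨k, h k hk⟩
    · rintro ⟨σ, hσ⟩
      obtain ⟨σ', h⟩ := exists_bounded_complete (hs := hs) (hd := hd) hb hds hW' hW1 hZ hv le_rfl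
        (bounded_of_exists_bounded hW' hv hσ)
      exact ⟨σ', fun τ' => ⟨_, h τ'⟩⟩
  have habs := G.abs_meanValue_le (W := W - 1) (fun x y => by linarith [hW x y]) s
  obtain ⟨h1, h2⟩ := abs_le.1 habs
  have hle := (key (G.meanValue s) (abs_le.2 ⟨by linarith, by linarith⟩)).2 le_rfl
  refine le_antisymm ?_ hle
  by_contra! hlt
  -- The completion has weights far above `W`, while `key` covers only `|v| ≤ W`. The spare `1` in
  -- the bound on the weights admits a test value just above the old mean value.
  have h3 : min ((G.complete s d hs hd Z).meanValue s) (G.meanValue s + 1) ≤ G.meanValue s := by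
    refine (key _ (abs_le.2 ⟨le_min (by linarith) (by linarith), ?_⟩)).1 (min_le_left _ _)
    exact (min_le_right _ _).trans (by linarith)
  rcases min_le_iff.1 h3 with h | h <;> linarith

end Complete

end GameGraph

end EnergyGames

/-! ### The bipartite form, in which one move becomes two. -/

namespace EnergyGames

namespace GameGraph

variable {V V' : Type}

/-- The weights of the bipartite form of a game graph. It has three copies of the node set. Alice
owns the copy `0` and Bob the other two. A node `(1, u)` only leads to `(0, u)`. A move of Alice from
`u` to `v` becomes a move from `(0, u)` to `(1, v)`, and one of Bob becomes a move from `(2, u)` to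
`(0, v)`, after a forced move from `(0, u)` to `(2, u)`. -/
def bipartiteWeight [DecidableEq V] (G : GameGraph V) (x y : Fin 3 × V) : Option ℤ :=
  if x.1 = 0 then
    if G.alice x.2 = true then
      if y.1 = 1 then (G.weight x.2 y.2).map (2 * ·) else none
    else if y.1 = 2 ∧ x.2 = y.2 then some 0 else none
  else if y.1 = 0 then
    if x.1 = 2 ∧ G.alice x.2 = false then (G.weight x.2 y.2).map (2 * ·)
    else if x.2 = y.2 then some 0 else none
  else none

/-- The bipartite form of a game graph, with nodes named by `e`. -/
def bipartite [DecidableEq V] (G : GameGraph V) (e : V' ≃ Fin 3 × V) : GameGraph V' where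
  alice x := decide ((e x).1 = 0)
  weight x y := G.bipartiteWeight (e x) (e y)
  exists_edge x := by
    obtain ⟨v, hv⟩ := G.exists_edge (e x).2
    by_cases h0 : (e x).1 = 0
    · by_cases ha : G.alice (e x).2 = true
      · exact ⟨e.symm (1, v), by simp [bipartiteWeight, h0, ha, hv]⟩
      · exact ⟨e.symm (2, (e x).2), by simp [bipartiteWeight, h0, ha]⟩
    · by_cases ha : (e x).1 = 2 ∧ G.alice (e x).2 = false
      · exact ⟨e.symm (0, v), by simp [bipartiteWeight, ha, hv]⟩
      · exact ⟨e.symm (0, (e x).2), by simp [bipartiteWeight, h0, ha]⟩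

section Bipartite

variable [DecidableEq V] {G : GameGraph V} {e : V' ≃ Fin 3 × V}

theorem bipartite_alice_iff {x : V'} : (G.bipartite e).alice x = true ↔ (e x).1 = 0 := by
  simp [bipartite]

theorem bipartite_bob_iff {x : V'} : (G.bipartite e).alice x = false ↔ (e x).1 ≠ 0 := by
  simp [bipartite]

theorem bipartite_edge_alice {u : V} (hu : G.alice u = true) {y : V'} :
    (G.bipartite e).Edge (e.symm (0, u)) y ↔ (e y).1 = 1 ∧ G.Edge u (e y).2 := by
  by_cases h : (e y).1 = 1 <;> simp [Edge, bipartite, bipartiteWeight, hu, h]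

theorem bipartite_edge_bob {u : V} (hu : G.alice u = false) {y : V'} :
    (G.bipartite e).Edge (e.symm (2, u)) y ↔ (e y).1 = 0 ∧ G.Edge u (e y).2 := by
  by_cases h : (e y).1 = 0 <;> simp [Edge, bipartite, bipartiteWeight, hu, h]

theorem bipartite_edge_to_bob {u : V} (hu : G.alice u = false) {y : V'} :
    (G.bipartite e).Edge (e.symm (0, u)) y ↔ y = e.symm (2, u) := by
  rw [Equiv.eq_symm_apply, Prod.ext_iff]
  by_cases h : (e y).1 = 2 ∧ u = (e y).2
  · simp [Edge, bipartite, bipartiteWeight, hu, ← h.2, h.1]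
  · simp [Edge, bipartite, bipartiteWeight, hu, h, eq_comm (a := (e y).2)]

theorem bipartite_edge_to_alice {u : V} {y : V'} :
    (G.bipartite e).Edge (e.symm (1, u)) y ↔ y = e.symm (0, u) := by
  rw [Equiv.eq_symm_apply, Prod.ext_iff]
  by_cases h : (e y).1 = 0 <;> by_cases h' : u = (e y).2 <;>
    simp [Edge, bipartite, bipartiteWeight, h, h', eq_comm (a := (e y).2)]

theorem bipartite_edge_ne (x y : V') (h : (G.bipartite e).Edge x y) :
    (G.bipartite e).alice x ≠ (G.bipartite e).alice y := by
  intro hxy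
  have hiff : (e x).1 = 0 ↔ (e y).1 = 0 := by
    rw [← bipartite_alice_iff (G := G), ← bipartite_alice_iff (G := G), hxy]
  by_cases h0 : (e x).1 = 0
  · simp [Edge, bipartite, bipartiteWeight, h0, hiff.1 h0] at h
  · simp [Edge, bipartite, bipartiteWeight, h0, mt hiff.2 h0] at h

theorem abs_bipartite_wt_le {W : ℚ} (hW : ∀ x y, |(G.wt x y : ℚ)| ≤ W) (x y : V') :
    |((G.bipartite e).wt x y : ℚ)| ≤ 2 * W := by
  have hW0 : 0 ≤ W := (abs_nonneg _).trans (hW (e x).2 (e x).2)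
  have h2 : |((((G.weight (e x).2 (e y).2).map (2 * ·)).getD 0 : ℤ) : ℚ)| ≤ 2 * W := by
    have := hW (e x).2 (e y).2
    unfold wt at this
    cases h : G.weight (e x).2 (e y).2 with
    | none => simpa using hW0
    | some w =>
      simp only [h, Option.getD_some, Option.map_some] at this ⊢
      push_cast
      rw [abs_mul, abs_two]
      linarith
  unfold wt bipartite bipartiteWeight
  dsimp only
  split_ifs <;> first | exact h2 | simpa using hW0

/-- The strategy `σ'` in the bipartite form makes the same moves as `σ`. -/
def AliceAgrees (σ : G.Strategy true) (σ' : (G.bipartite e).Strategy true) : Prop :=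
  ∀ u (h : G.alice u = true), (σ' (e.symm (0, u)) (by simp [bipartite])).1 = e.symm (1, (σ u h).1)

/-- The strategy `τ'` in the bipartite form makes the same moves as `τ`. -/
def BobAgrees (τ : G.Strategy false) (τ' : (G.bipartite e).Strategy false) : Prop :=
  ∀ u (h : G.alice u = false), (τ' (e.symm (2, u)) (by simp [bipartite])).1 = e.symm (0, (τ u h).1)

/-- Translating one player's strategies in one direction and the other's in the opposite one carries
"some `σ` against all `τ`" across the bipartite form. Where agreement demands nothing, the move is
forced, so agreeing strategies yield corresponding plays. -/
theorem exists_aliceAgrees_left (σ' : (G.bipartite e).Strategy true) :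
    ∃ σ, AliceAgrees σ σ' := by
  have key : ∀ u (h : G.alice u = true), _ := fun u h =>
    (bipartite_edge_alice h).1 (σ' (e.symm (0, u)) (by simp [bipartite])).2
  refine ⟨fun u h => ⟨_, (key u h).2⟩, fun u h => ?_⟩
  rw [Equiv.eq_symm_apply, Prod.ext_iff]
  exact ⟨(key u h).1, rfl⟩

theorem exists_bobAgrees_left (τ' : (G.bipartite e).Strategy false) :
    ∃ τ, BobAgrees τ τ' := by
  have key : ∀ u (h : G.alice u = false), _ := fun u h =>
    (bipartite_edge_bob h).1 (τ' (e.symm (2, u)) (by simp [bipartite])).2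
  refine ⟨fun u h => ⟨_, (key u h).2⟩, fun u h => ?_⟩
  rw [Equiv.eq_symm_apply, Prod.ext_iff]
  exact ⟨(key u h).1, rfl⟩

theorem exists_aliceAgrees_right (σ : G.Strategy true) :
    ∃ σ' : (G.bipartite e).Strategy true, AliceAgrees σ σ' := by
  have key : ∀ x (_ : (G.bipartite e).alice x = true), ∃ y, (G.bipartite e).Edge x y ∧
      ∀ u (h : G.alice u = true), x = e.symm (0, u) → y = e.symm (1, (σ u h).1) := by
    intro x hx
    by_cases hex : ∃ u, G.alice u = true ∧ x = e.symm (0, u)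
    · obtain ⟨u, hu, rfl⟩ := hex
      refine ⟨e.symm (1, (σ u hu).1), ?_, fun u' h' hu' => ?_⟩
      · simpa [bipartite_edge_alice hu] using (σ u hu).2
      · obtain rfl : u = u' := by simpa using hu'
        rfl
    · obtain ⟨y, hy⟩ := (G.bipartite e).exists_edge x
      exact ⟨y, hy, fun u h hu => absurd ⟨u, h, hu⟩ hex⟩
  choose f hf hf' using key
  exact ⟨fun x hx => ⟨f x hx, hf x hx⟩, fun u h => hf' _ _ u h rfl⟩

theorem exists_bobAgrees_right (τ : G.Strategy false) :
    ∃ τ' : (G.bipartite e).Strategy false, BobAgrees τ τ' := by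
  have key : ∀ x (_ : (G.bipartite e).alice x = false), ∃ y, (G.bipartite e).Edge x y ∧
      ∀ u (h : G.alice u = false), x = e.symm (2, u) → y = e.symm (0, (τ u h).1) := by
    intro x hx
    by_cases hex : ∃ u, G.alice u = false ∧ x = e.symm (2, u)
    · obtain ⟨u, hu, rfl⟩ := hex
      refine ⟨e.symm (0, (τ u hu).1), ?_, fun u' h' hu' => ?_⟩
      · simpa [bipartite_edge_bob hu] using (τ u hu).2
      · obtain rfl : u = u' := by simpa using hu'
        rfl
    · obtain ⟨y, hy⟩ := (G.bipartite e).exists_edge x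
      exact ⟨y, hy, fun u h hu => absurd ⟨u, h, hu⟩ hex⟩
  choose f hf hf' using key
  exact ⟨fun x hx => ⟨f x hx, hf x hx⟩, fun u h => hf' _ _ u h rfl⟩

section Agree

variable {σ : G.Strategy true} {σ' : (G.bipartite e).Strategy true} {τ : G.Strategy false}
  {τ' : (G.bipartite e).Strategy false}

theorem bipartite_two_moves (hσ : AliceAgrees σ σ') (hτ : BobAgrees τ τ') (u : V) :
    ∃ x, (G.bipartite e).next σ' τ' (e.symm (0, u)) = x ∧
      (G.bipartite e).next σ' τ' x = e.symm (0, G.next σ τ u) ∧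
      ((G.bipartite e).wt (e.symm (0, u)) x = 2 * G.wt u (G.next σ τ u) ∧
        (G.bipartite e).wt x (e.symm (0, G.next σ τ u)) = 0 ∨
      (G.bipartite e).wt (e.symm (0, u)) x = 0 ∧
        (G.bipartite e).wt x (e.symm (0, G.next σ τ u)) = 2 * G.wt u (G.next σ τ u)) := by
  have hmap : ∀ o : Option ℤ, (o.map (2 * ·)).getD 0 = 2 * o.getD 0 := by
    rintro (_ | _) <;> simp
  cases hu : G.alice u with
  | true =>
    have h1 : (G.bipartite e).next σ' τ' (e.symm (0, u)) = e.symm (1, G.next σ τ u) := by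
      rw [next_of_alice _ _ _ (by simp [bipartite]), hσ u hu, next_of_alice G σ τ hu]
    refine ⟨_, h1, bipartite_edge_to_alice.1 (edge_next _ _ _ _), Or.inl ⟨?_, ?_⟩⟩
    · simp [wt, bipartite, bipartiteWeight, hu, hmap]
    · simp [wt, bipartite, bipartiteWeight]
  | false =>
    have h1 : (G.bipartite e).next σ' τ' (e.symm (0, u)) = e.symm (2, u) :=
      (bipartite_edge_to_bob hu).1 (edge_next _ _ _ _)
    refine ⟨_, h1, ?_, Or.inr ⟨?_, ?_⟩⟩
    · rw [next_of_bob _ _ _ (by simp [bipartite]), hτ u hu, next_of_bob G σ τ hu]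
    · simp [wt, bipartite, bipartiteWeight, hu]
    · simp [wt, bipartite, bipartiteWeight, hu, hmap]

theorem bipartite_iterate (hσ : AliceAgrees σ σ') (hτ : BobAgrees τ τ') (s : V) (i : ℕ) :
    ((G.bipartite e).next σ' τ')^[2 * i] (e.symm (0, s)) = e.symm (0, (G.next σ τ)^[i] s) := by
  induction i with
  | zero => rfl
  | succ i ih =>
    obtain ⟨x, h1, h2, -⟩ := bipartite_two_moves hσ hτ ((G.next σ τ)^[i] s)
    rw [show 2 * (i + 1) = 2 * i + 1 + 1 by ring, Function.iterate_succ_apply',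
      Function.iterate_succ_apply', ih, h1, h2, Function.iterate_succ_apply']

/-- Halfway through a doubled move, the weight has been counted in full (Alice) or not at all (Bob),
so the intermediate times create no new prefix weights. -/
theorem bipartite_pathWeight (hσ : AliceAgrees σ σ') (hτ : BobAgrees τ τ') (s : V) (i : ℕ) :
    (G.bipartite e).pathWeight σ' τ' (e.symm (0, s)) (2 * i) = 2 * G.pathWeight σ τ s i ∧
    ((G.bipartite e).pathWeight σ' τ' (e.symm (0, s)) (2 * i + 1) = 2 * G.pathWeight σ τ s i ∨
      (G.bipartite e).pathWeight σ' τ' (e.symm (0, s)) (2 * i + 1) =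
        2 * G.pathWeight σ τ s (i + 1)) := by
  induction i with
  | zero =>
    obtain ⟨x, h1, h2, h3⟩ := bipartite_two_moves hσ hτ s
    simp only [Nat.mul_zero, pathWeight_succ, pathWeight_zero, Function.iterate_zero, id,
      Function.iterate_succ, Function.comp, h1]
    rcases h3 with h | h <;> simp [h.1]
  | succ i ih =>
    have hstep : (G.bipartite e).pathWeight σ' τ' (e.symm (0, s)) (2 * (i + 1)) =
        2 * G.pathWeight σ τ s (i + 1) := by
      obtain ⟨x, h1, h2, h3⟩ := bipartite_two_moves hσ hτ ((G.next σ τ)^[i] s)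
      rw [show 2 * (i + 1) = 2 * i + 1 + 1 by ring, pathWeight_succ, pathWeight_succ, ih.1,
        Function.iterate_succ_apply' _ (2 * i + 1), Function.iterate_succ_apply' _ (2 * i),
        bipartite_iterate hσ hτ, h1, h2, pathWeight_succ, Function.iterate_succ_apply']
      rcases h3 with h | h <;> rw [h.1, h.2] <;> ring
    refine ⟨hstep, ?_⟩
    obtain ⟨x, h1, h2, h3⟩ := bipartite_two_moves hσ hτ ((G.next σ τ)^[i + 1] s)
    rw [pathWeight_succ, hstep, pathWeight_succ _ _ _ _ (i + 1), Function.iterate_succ_apply',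
      bipartite_iterate hσ hτ, h1, Function.iterate_succ_apply' _ (i + 1)]
    rcases h3 with h | h <;> rw [h.1]
    · right; ring
    · left; ring

/-- At odd times the count of moves is off by one from that of the matching prefix, which costs
`|v|`. For `v = 0` the energy exactly doubles. -/
theorem Bounded.bipartite (hσ : AliceAgrees σ σ') (hτ : BobAgrees τ τ') {s : V} {v k : ℚ}
    (h : G.Bounded σ τ s v k) :
    (G.bipartite e).Bounded σ' τ' (e.symm (0, s)) v (2 * k + |v|) := by
  intro i
  have h1 := le_abs_self v
  have h2 := neg_abs_le v
  obtain ⟨j, rfl | rfl⟩ := Nat.even_or_odd' i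
  · rw [(bipartite_pathWeight hσ hτ s j).1]
    have := h j
    push_cast
    linarith [abs_nonneg v]
  · rcases (bipartite_pathWeight hσ hτ s j).2 with hp | hp <;> rw [hp]
    · have := h j
      push_cast
      linarith
    · have := h (j + 1)
      push_cast at this ⊢
      linarith

theorem Bounded.of_bipartite (hσ : AliceAgrees σ σ') (hτ : BobAgrees τ τ') {s : V} {v k : ℚ}
    (h : (G.bipartite e).Bounded σ' τ' (e.symm (0, s)) v k) : G.Bounded σ τ s v (k / 2) := by
  intro i
  have := h (2 * i)
  rw [(bipartite_pathWeight hσ hτ s i).1] at this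
  push_cast at this
  linarith

end Agree

theorem bipartite_meanValue [Fintype V] [Fintype V'] (s : V) :
    (G.bipartite e).meanValue (e.symm (0, s)) = G.meanValue s := by
  refine eq_of_forall_le_iff fun v => ?_
  rw [le_meanValue_iff, le_meanValue_iff]
  constructor
  · rintro ⟨σ', h⟩
    obtain ⟨σ, hσ⟩ := exists_aliceAgrees_left σ'
    refine ⟨σ, fun τ => ?_⟩
    obtain ⟨τ', hτ⟩ := exists_bobAgrees_right (e := e) τ
    obtain ⟨k, hk⟩ := h τ'
    exact ⟨_, hk.of_bipartite hσ hτ⟩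
  · rintro ⟨σ, h⟩
    obtain ⟨σ', hσ⟩ := exists_aliceAgrees_right (e := e) σ
    refine ⟨σ', fun τ' => ?_⟩
    obtain ⟨τ, hτ⟩ := exists_bobAgrees_left τ'
    obtain ⟨k, hk⟩ := h τ
    exact ⟨_, hk.bipartite hσ hτ⟩

theorem bipartite_minEnergy_le_iff [Finite V] [Finite V'] (s : V) (m : ℕ) :
    (G.bipartite e).minEnergy (e.symm (0, s)) ≤ m ↔ G.minEnergy s ≤ (m / 2 : ℕ) := by
  rw [minEnergy_le_iff, minEnergy_le_iff]
  constructor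
  · rintro ⟨σ', h⟩
    obtain ⟨σ, hσ⟩ := exists_aliceAgrees_left σ'
    refine ⟨σ, fun τ => ?_⟩
    obtain ⟨τ', hτ⟩ := exists_bobAgrees_right (e := e) τ
    rw [← sustains_iff_bounded]
    intro i
    have hi := (h τ').of_bipartite hσ hτ i
    have h2 : (0 : ℚ) ≤ m + 2 * G.pathWeight σ τ s i := by linarith
    have h3 : (0 : ℤ) ≤ m + 2 * G.pathWeight σ τ s i := by exact_mod_cast h2
    omega
  · rintro ⟨σ, h⟩
    obtain ⟨σ', hσ⟩ := exists_aliceAgrees_right (e := e) σ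
    refine ⟨σ', fun τ' => ?_⟩
    obtain ⟨τ, hτ⟩ := exists_bobAgrees_left τ'
    refine ((h τ).bipartite hσ hτ).mono ?_
    have h1 : 2 * (m / 2) ≤ m := Nat.mul_div_le m 2
    have h2 : (2 * (m / 2 : ℕ) : ℚ) ≤ m := by exact_mod_cast h1
    simpa using h2

/-- Integer division rounds `-1 / 2` to `-1`, so halving also respects the code of infinity. -/
theorem ofENat_minEnergy_eq_bipartite [Finite V] [Finite V'] (s : V) :
    Data.ofENat (G.minEnergy s) =
      .int ((Data.ofENat ((G.bipartite e).minEnergy (e.symm (0, s)))).toInt / 2) := by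
  have key := bipartite_minEnergy_le_iff (G := G) (e := e) s
  generalize (G.bipartite e).minEnergy (e.symm (0, s)) = a at key
  generalize G.minEnergy s = b at key
  unfold Data.ofENat
  induction b using ENat.recTopCoe with
  | top =>
    have : a = ⊤ := by
      induction a using ENat.recTopCoe with
      | top => rfl
      | coe a => simpa using (key a).1 le_rfl
    subst this
    simp [Data.toInt]
  | coe b =>
    induction a using ENat.recTopCoe with
    | top =>
      have := (key (2 * b)).2 (by simp)
      simp at this
      exact absurd this (by exact_mod_cast ENat.natCast_ne_top (2 * b))
    | coe a =>
      have h1 := (key a).1 le_rfl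
      have h2 := (key (2 * b)).2 (by simp)
      norm_cast at h1 h2
      have h3 : b = a / 2 := by omega
      simp [Data.toInt, h3]

end Bipartite

end GameGraph

end EnergyGames

/-! ### Closure properties of polynomial-time computation with an oracle. -/

namespace EnergyGames

/-! ### Polynomial bounds -/

theorem polynomial_eval_mono (p : Polynomial ℕ) : Monotone fun n => p.eval n := by
  intro a b h
  simp only [Polynomial.eval_eq_sum_range]
  gcongr

/-- `f` is bounded by a polynomial in `g`. -/
def PolyBounded {α : Type} (f g : α → ℕ) : Prop := ∃ p : Polynomial ℕ, ∀ a, f a ≤ p.eval (g a)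

namespace PolyBounded

variable {α β : Type} {f f' g h : α → ℕ}

theorem refl (f : α → ℕ) : PolyBounded f f := ⟨Polynomial.X, fun a => by simp⟩

theorem const (k : ℕ) (g : α → ℕ) : PolyBounded (fun _ => k) g :=
  ⟨Polynomial.C k, fun a => by simp⟩

theorem of_le (hf : ∀ a, f a ≤ f' a) (h : PolyBounded f' g) : PolyBounded f g :=
  let ⟨p, hp⟩ := h
  ⟨p, fun a => (hf a).trans (hp a)⟩

theorem add (h : PolyBounded f g) (h' : PolyBounded f' g) :
    PolyBounded (fun a => f a + f' a) g :=
  let ⟨p, hp⟩ := h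
  let ⟨q, hq⟩ := h'
  ⟨p + q, fun a => by rw [Polynomial.eval_add]; exact add_le_add (hp a) (hq a)⟩

theorem mul (h : PolyBounded f g) (h' : PolyBounded f' g) :
    PolyBounded (fun a => f a * f' a) g :=
  let ⟨p, hp⟩ := h
  let ⟨q, hq⟩ := h'
  ⟨p * q, fun a => by rw [Polynomial.eval_mul]; exact Nat.mul_le_mul (hp a) (hq a)⟩

theorem trans (h : PolyBounded f g) (h' : PolyBounded g f') : PolyBounded f f' :=
  let ⟨p, hp⟩ := h
  let ⟨q, hq⟩ := h'
  ⟨p.comp q, fun a => by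
    rw [Polynomial.eval_comp]
    exact (hp a).trans (polynomial_eval_mono p (hq a))⟩

theorem comp (h : PolyBounded f g) (φ : β → α) : PolyBounded (fun b => f (φ b)) fun b => g (φ b) :=
  let ⟨p, hp⟩ := h
  ⟨p, fun b => hp (φ b)⟩

end PolyBounded

namespace Data

theorem size_pos (x : Data) : 0 < x.size := by cases x <;> simp [size]

theorem size_int_le_iff {z : ℤ} {m : ℕ} : (int z).size ≤ m + 1 ↔ z.natAbs < 2 ^ m := by
  rw [size, Nat.add_le_add_iff_right, Nat.size_le]

theorem natAbs_lt_size (z : ℤ) : z.natAbs < 2 ^ (int z).size := by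
  rw [← size_int_le_iff]
  omega

theorem size_int_natCast_le (n : ℕ) : (int n).size ≤ n + 1 := by
  rw [size_int_le_iff]
  exact Nat.lt_two_pow_self

theorem size_ofBool_le (b : Bool) : (ofBool b).size ≤ 2 := by
  cases b <;> simp [ofBool, size]

theorem size_fst_le (x : Data) : x.fst.size ≤ x.size := by
  cases x with
  | int z => simp [fst, size]
  | pair a b => simp only [fst, size]; omega

theorem size_snd_le (x : Data) : x.snd.size ≤ x.size := by
  cases x with
  | int z => simp [snd, size]
  | pair a b => simp only [snd, size]; omega

theorem natAbs_toInt_lt (x : Data) : x.toInt.natAbs < 2 ^ x.size := by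
  cases x with
  | int z => exact natAbs_lt_size z
  | pair a b => simp [toInt]

theorem truthy_ofBool {b : Bool} : (ofBool b).Truthy ↔ b = true := by
  cases b <;> simp [ofBool, Truthy]

theorem length_lt_size_ofList (l : List Data) : l.length < (ofList l).size := by
  induction l with
  | nil => simp [ofList, size]
  | cons a l ih => simp only [ofList, size, List.length_cons]; have := a.size_pos; omega

theorem size_lt_size_ofList {l : List Data} {a : Data} (h : a ∈ l) : a.size < (ofList l).size := by
  induction l with
  | nil => simp at h
  | cons b l ih =>
    simp only [ofList, size]
    rcases List.mem_cons.1 h with rfl | h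
    · omega
    · have := ih h; omega

theorem size_ofList_le {l : List Data} {B : ℕ} (h : ∀ a ∈ l, a.size ≤ B) :
    (ofList l).size ≤ 1 + l.length * (B + 1) := by
  induction l with
  | nil => simp [ofList, size]
  | cons a l ih =>
    simp only [ofList, size, List.length_cons]
    have h1 := ih fun b hb => h b (List.mem_cons_of_mem _ hb)
    have h2 := h a List.mem_cons_self
    rw [Nat.succ_mul]
    omega

theorem size_ofList_drop_le (l : List Data) (k : ℕ) :
    (ofList (l.drop k)).size ≤ (ofList l).size := by
  induction l generalizing k with
  | nil => simp
  | cons a l ih =>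
    cases k with
    | zero => simp
    | succ k =>
      have := ih k
      simp only [List.drop_succ_cons, ofList, size]
      omega

end Data

theorem Prim.size_eval_le (o : Prim) : PolyBounded (fun x : Data => (o.eval x).size) Data.size := by
  -- One crude bound serves all four arithmetic operations: the bit length at most adds up, plus a
  -- constant.
  have harith : ∀ f : ℤ → ℤ → ℤ, (∀ a b, (f a b).natAbs ≤ (a.natAbs + 1) * (b.natAbs + 1)) →
      PolyBounded (fun x : Data => (Data.int (f x.fst.toInt x.snd.toInt)).size) Data.size := by
    intro f hf
    refine PolyBounded.of_le (f' := fun x => x.size + x.size + 1 + 1 + 1) (fun x => ?_)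
      (((((PolyBounded.refl _).add (.refl _)).add (.const 1 _)).add (.const 1 _)).add (.const 1 _))
    rw [Data.size_int_le_iff]
    have h1 := (Data.natAbs_toInt_lt x.fst).trans_le
      (Nat.pow_le_pow_right two_pos (Data.size_fst_le x))
    have h2 := (Data.natAbs_toInt_lt x.snd).trans_le
      (Nat.pow_le_pow_right two_pos (Data.size_snd_le x))
    calc (f x.fst.toInt x.snd.toInt).natAbs
        ≤ (x.fst.toInt.natAbs + 1) * (x.snd.toInt.natAbs + 1) := hf _ _
      _ ≤ 2 ^ x.size * 2 ^ x.size := Nat.mul_le_mul h1 h2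
      _ = 2 ^ (x.size + x.size) := (pow_add _ _ _).symm
      _ < 2 ^ (x.size + x.size + 1 + 1) := Nat.pow_lt_pow_right (by norm_num) (by omega)
  cases o with
  | id => exact .refl _
  | const z => exact .const _ _
  | fst => exact .of_le Data.size_fst_le (.refl _)
  | snd => exact .of_le Data.size_snd_le (.refl _)
  | isPair => exact .of_le (fun _ => Data.size_ofBool_le _) (.const 2 _)
  | add =>
    refine harith (· + ·) fun a b => ?_
    have := Int.natAbs_add_le a b
    generalize a.natAbs = m, b.natAbs = n, (a + b).natAbs = k at this ⊢
    nlinarith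
  | sub =>
    refine harith (· - ·) fun a b => ?_
    have := Int.natAbs_sub_le a b
    generalize a.natAbs = m, b.natAbs = n, (a - b).natAbs = k at this ⊢
    nlinarith
  | mul =>
    refine harith (· * ·) fun a b => ?_
    simp only [Int.natAbs_mul]
    gcongr <;> omega
  | div =>
    refine harith (· / ·) fun a b => ?_
    have := Int.natAbs_ediv_le_natAbs a b
    generalize a.natAbs = m, b.natAbs = n, (a / b).natAbs = k at this ⊢
    nlinarith
  | le => exact .of_le (fun _ => Data.size_ofBool_le _) (.const 2 _)

/-- Every step pays for its input and output. Hence time bounds also bound sizes, which makes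
polynomial time closed under composition. -/
theorem Runs.size_le {O : Data → Data} {c : Code} {x y : Data} {t : ℕ} (h : Runs O c x y t) :
    x.size ≤ t ∧ y.size ≤ t := by
  induction h with
  | prim o x => omega
  | pair _ _ ih1 ih2 => simp only [Data.size]; omega
  | comp _ _ ih1 ih2 => omega
  | ite_true _ _ _ ih1 ih2 => omega
  | ite_false _ _ _ ih1 ih2 => omega
  | loop_done _ _ ih => omega
  | loop_step _ _ _ _ ih1 ih2 ih3 => omega
  | oracle x => omega

/-- Size bounds are read off from a run, which needs some correct oracle; injectivity of the
encoding makes one well defined. -/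
theorem Problem.exists_solvedBy (Q : Problem) : ∃ O, Q.SolvedBy O := by
  classical
  refine ⟨fun d => if h : ∃ x, Q.encode x = d then Q.answer h.choose else d, fun x => ?_⟩
  have hex : ∃ x', Q.encode x' = Q.encode x := ⟨x, rfl⟩
  dsimp only
  rw [dif_pos hex, Q.encode_injective hex.choose_spec]

/-! ### Polynomial-time computability with an oracle -/

/-- With an oracle for `Q`, one program computes `y a` from `x a` in polynomial time,
for all `a`. -/
def PolyComputable (Q : Problem) {α : Type} (x y : α → Data) : Prop :=
  ∃ (c : Code) (p : Polynomial ℕ), ∀ O : Data → Data, Q.SolvedBy O →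
    ∀ a, ∃ t : ℕ, t ≤ p.eval (x a).size ∧ Runs O c (x a) (y a) t

namespace PolyComputable

variable {Q : Problem} {α β : Type} {x y z : α → Data}

theorem size_le (h : PolyComputable Q x y) :
    PolyBounded (fun a => (y a).size) fun a => (x a).size := by
  obtain ⟨c, p, h⟩ := h
  obtain ⟨O, hO⟩ := Q.exists_solvedBy
  refine ⟨p, fun a => ?_⟩
  obtain ⟨t, ht, hr⟩ := h O hO a
  exact hr.size_le.2.trans ht

theorem prim (o : Prim) (x : α → Data) : PolyComputable Q x fun a => o.eval (x a) := by
  obtain ⟨p, hp⟩ := o.size_eval_le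
  refine ⟨.prim o, 1 + Polynomial.X + p, fun O _ a => ⟨_, ?_, Runs.prim o (x a)⟩⟩
  have := hp (x a)
  simpa using this

theorem id (x : α → Data) : PolyComputable Q x x := prim .id x

theorem comp (h : PolyComputable Q x y) (h' : PolyComputable Q y z) : PolyComputable Q x z := by
  obtain ⟨c, p, h⟩ := h
  obtain ⟨c', p', h'⟩ := h'
  refine ⟨.comp c' c, 1 + p + p'.comp p, fun O hO a => ?_⟩
  obtain ⟨s, hs, hr⟩ := h O hO a
  obtain ⟨t, ht, hr'⟩ := h' O hO a
  refine ⟨_, ?_, Runs.comp hr hr'⟩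
  have := polynomial_eval_mono p' (hr.size_le.2.trans hs)
  simp only [Polynomial.eval_add, Polynomial.eval_one, Polynomial.eval_comp] at this ⊢
  omega

theorem pair (h : PolyComputable Q x y) (h' : PolyComputable Q x z) :
    PolyComputable Q x fun a => (y a).pair (z a) := by
  obtain ⟨c, p, h⟩ := h
  obtain ⟨c', p', h'⟩ := h'
  refine ⟨.pair c c', 1 + p + p', fun O hO a => ?_⟩
  obtain ⟨s, hs, hr⟩ := h O hO a
  obtain ⟨t, ht, hr'⟩ := h' O hO a
  refine ⟨_, ?_, Runs.pair hr hr'⟩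
  simp only [Polynomial.eval_add, Polynomial.eval_one]
  omega

theorem reindex (h : PolyComputable Q x y) (φ : β → α) :
    PolyComputable Q (fun b => x (φ b)) fun b => y (φ b) :=
  let ⟨c, p, h⟩ := h
  ⟨c, p, fun O hO b => h O hO (φ b)⟩

/-- If `x` is available in a larger environment, so is everything computable from `x`. -/
theorem of_env (h : PolyComputable Q x y) {x' : β → Data} {φ : β → α}
    (hx : PolyComputable Q x' fun b => x (φ b)) : PolyComputable Q x' fun b => y (φ b) :=
  hx.comp (h.reindex φ)

theorem congr (h : PolyComputable Q x y) (hyz : ∀ a, y a = z a) : PolyComputable Q x z := by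
  obtain rfl : y = z := funext hyz
  exact h

theorem const (x : α → Data) (k : ℤ) : PolyComputable Q x fun _ => .int k := prim (.const k) x

theorem fst (h : PolyComputable Q x y) : PolyComputable Q x fun a => (y a).fst :=
  h.comp (prim .fst y)

theorem snd (h : PolyComputable Q x y) : PolyComputable Q x fun a => (y a).snd :=
  h.comp (prim .snd y)

theorem isPair (h : PolyComputable Q x y) : PolyComputable Q x fun a => .ofBool (y a).isPair :=
  h.comp (prim .isPair y)

theorem add {m n : α → ℤ} (h : PolyComputable Q x fun a => .int (m a))
    (h' : PolyComputable Q x fun a => .int (n a)) :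
    PolyComputable Q x fun a => .int (m a + n a) :=
  (h.pair h').comp (prim .add _)

theorem sub {m n : α → ℤ} (h : PolyComputable Q x fun a => .int (m a))
    (h' : PolyComputable Q x fun a => .int (n a)) :
    PolyComputable Q x fun a => .int (m a - n a) :=
  (h.pair h').comp (prim .sub _)

theorem mul {m n : α → ℤ} (h : PolyComputable Q x fun a => .int (m a))
    (h' : PolyComputable Q x fun a => .int (n a)) :
    PolyComputable Q x fun a => .int (m a * n a) :=
  (h.pair h').comp (prim .mul _)

theorem div {m n : α → ℤ} (h : PolyComputable Q x fun a => .int (m a))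
    (h' : PolyComputable Q x fun a => .int (n a)) :
    PolyComputable Q x fun a => .int (m a / n a) :=
  (h.pair h').comp (prim .div _)

theorem toInt (h : PolyComputable Q x y) : PolyComputable Q x fun a => .int (y a).toInt :=
  ((h.pair (const x 0)).comp (prim .add _)).congr fun a => by
    simp [Prim.eval, Data.fst, Data.snd, Data.toInt]

theorem ite_truthy {b : α → Data} {P : α → Prop} [DecidablePred P] (hb : PolyComputable Q x b)
    (hP : ∀ a, (b a).Truthy ↔ P a) (h : PolyComputable Q x y) (h' : PolyComputable Q x z) :
    PolyComputable Q x fun a => if P a then y a else z a := by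
  obtain ⟨cb, pb, hb⟩ := hb
  obtain ⟨c, p, h⟩ := h
  obtain ⟨c', p', h'⟩ := h'
  refine ⟨.ite cb c c', 1 + pb + p + p', fun O hO a => ?_⟩
  obtain ⟨r, hr, hrb⟩ := hb O hO a
  obtain ⟨s, hs, hrs⟩ := h O hO a
  obtain ⟨t, ht, hrt⟩ := h' O hO a
  simp only [Polynomial.eval_add, Polynomial.eval_one]
  by_cases hPa : P a
  · rw [if_pos hPa]
    exact ⟨_, by omega, Runs.ite_true hrb ((hP a).2 hPa) hrs⟩
  · rw [if_neg hPa]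
    exact ⟨_, by omega, Runs.ite_false hrb (mt (hP a).1 hPa) hrt⟩

theorem ite {P : α → Prop} [DecidablePred P]
    (hP : PolyComputable Q x fun a => .ofBool (decide (P a)))
    (h : PolyComputable Q x y) (h' : PolyComputable Q x z) :
    PolyComputable Q x fun a => if P a then y a else z a :=
  ite_truthy hP (fun a => by rw [Data.truthy_ofBool, decide_eq_true_iff]) h h'

theorem decide_eq {m n : α → ℤ} (h : PolyComputable Q x fun a => .int (m a))
    (h' : PolyComputable Q x fun a => .int (n a)) :
    PolyComputable Q x fun a => .ofBool (decide (m a = n a)) :=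
  (ite_truthy (P := fun a => m a ≠ n a) (h.sub h')
    (fun a => by simp [Data.Truthy, sub_eq_zero]) (const x 0) (const x 1)).congr fun a => by
      by_cases hmn : m a = n a <;> simp [Data.ofBool, hmn]

theorem decide_and {P P' : α → Prop} [DecidablePred P] [DecidablePred P']
    (h : PolyComputable Q x fun a => .ofBool (decide (P a)))
    (h' : PolyComputable Q x fun a => .ofBool (decide (P' a))) :
    PolyComputable Q x fun a => .ofBool (decide (P a ∧ P' a)) :=
  (h.ite h' (const x 0)).congr fun a => by
    by_cases hP : P a <;> simp [Data.ofBool, hP]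

theorem decide_not {P : α → Prop} [DecidablePred P]
    (h : PolyComputable Q x fun a => .ofBool (decide (P a))) :
    PolyComputable Q x fun a => .ofBool (decide (¬ P a)) :=
  (h.ite (const x 0) (const x 1)).congr fun a => by
    by_cases hP : P a <;> simp [Data.ofBool, hP]

/-- A call is charged for the answer, so polynomially short answers have to be assumed. -/
theorem oracle (hQ : PolyBounded (fun I => (Q.answer I).size) fun I => (Q.encode I).size)
    {I : α → Q.Inst} (h : PolyComputable Q x fun a => Q.encode (I a)) :
    PolyComputable Q x fun a => Q.answer (I a) := by
  obtain ⟨p, hp⟩ := hQ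
  refine h.comp ⟨.oracle, 1 + Polynomial.X + p, fun O hO a => ?_⟩
  have hr := Runs.oracle (O := O) (Q.encode (I a))
  rw [hO (I a)] at hr
  refine ⟨_, ?_, hr⟩
  have := hp (I a)
  simpa using this

/-! ### Loops -/

/-- Test and body are computable uniformly in the input and the iteration. The bound on all states
is a separate hypothesis because polynomial growth per iteration could compound. -/
theorem while_loop (N : α → ℕ) (st : α → ℕ → Data) {b : (Σ a, Fin (N a + 1)) → Data}
    (hb : PolyComputable Q (fun q : Σ a, Fin (N a + 1) => st q.1 q.2) b)
    (hbN : ∀ q, (b q).Truthy ↔ (q.2 : ℕ) < N q.1)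
    (hf : PolyComputable Q (fun q : Σ a, Fin (N a) => st q.1 q.2) fun q => st q.1 (q.2 + 1))
    (hN : PolyBounded N fun a => (st a 0).size)
    (hst : PolyBounded (fun q : Σ a, Fin (N a + 1) => (st q.1 q.2).size) fun q => (st q.1 0).size) :
    PolyComputable Q (fun a => st a 0) fun a => st a (N a) := by
  obtain ⟨cb, pb, hb⟩ := hb
  obtain ⟨c, p, hf⟩ := hf
  obtain ⟨pN, hN⟩ := hN
  obtain ⟨ps, hst⟩ := hst
  refine ⟨.loop cb c, (pN + 1) * (1 + pb.comp ps + p.comp ps), fun O hO a => ?_⟩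
  have hst' : ∀ i ≤ N a, (st a i).size ≤ ps.eval (st a 0).size := fun i hi =>
    hst ⟨a, i, Nat.lt_succ_of_le hi⟩
  generalize hB : 1 + pb.eval (ps.eval (st a 0).size) + p.eval (ps.eval (st a 0).size) = B
  -- Induction on the number of iterations left, since `Runs.loop_step` unrolls from the front.
  have key : ∀ k ≤ N a, ∃ t ≤ (k + 1) * B,
      Runs O (.loop cb c) (st a (N a - k)) (st a (N a)) t := by
    intro k
    induction k with
    | zero =>
      intro _
      obtain ⟨t, ht, hr⟩ := hb O hO ⟨a, N a, Nat.lt_succ_self _⟩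
      refine ⟨1 + t, ?_, Runs.loop_done hr (by simp [hbN])⟩
      have := polynomial_eval_mono pb (hst' (N a) le_rfl)
      simp only at this ht
      omega
    | succ k ih =>
      intro hk
      obtain ⟨u, hu, hru⟩ := ih (by omega)
      obtain ⟨t, ht, hr⟩ := hb O hO ⟨a, N a - (k + 1), by omega⟩
      obtain ⟨s, hs, hrs⟩ := hf O hO ⟨a, N a - (k + 1), by omega⟩
      simp only [show N a - (k + 1) + 1 = N a - k by omega] at ht hs hr hrs
      refine ⟨_, ?_, Runs.loop_step hr ((hbN _).2 ?_) hrs hru⟩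
      · have h1 := polynomial_eval_mono pb (hst' (N a - (k + 1)) (by omega))
        have h2 := polynomial_eval_mono p (hst' (N a - (k + 1)) (by omega))
        simp only at h1 h2
        rw [Nat.succ_mul]
        omega
      · simp only
        omega
  obtain ⟨t, ht, hr⟩ := key (N a) le_rfl
  rw [Nat.sub_self] at hr
  refine ⟨t, ht.trans ?_, hr⟩
  simp only [Polynomial.eval_add, Polynomial.eval_mul, Polynomial.eval_one, Polynomial.eval_comp,
    hB]
  have := hN a
  gcongr

theorem for_loop {N : α → ℕ} {acc : α → ℕ → Data}
    (hN : PolyComputable Q x fun a => .int (N a))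
    (h0 : PolyComputable Q x fun a => acc a 0)
    (hstep : PolyComputable Q
      (fun q : Σ a, Fin (N a) => .pair (.int q.2) (.pair (acc q.1 q.2) (x q.1)))
      fun q => acc q.1 (q.2 + 1))
    (hNx : PolyBounded N fun a => (x a).size)
    (hacc : PolyBounded (fun q : Σ a, Fin (N a + 1) => (acc q.1 q.2).size)
      fun q => (x q.1).size) :
    PolyComputable Q x fun a => acc a (N a) := by
  let st : α → ℕ → Data := fun a i =>
    .pair (.int i) (.pair (acc a i) (.pair (.int (N a)) (x a)))
  have hx : PolyBounded (fun a => (x a).size) fun a => (st a 0).size :=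
    .of_le (fun a => by simp only [st, Data.size]; omega) (.refl _)
  have hloop : PolyComputable Q (fun a => st a 0) fun a => st a (N a) := by
    -- The counter stays at most `N`, so the difference is nonzero, hence truthy, exactly while
    -- iterations remain.
    refine while_loop N st (b := fun q => .int ((N q.1 : ℤ) - (q.2 : ℕ))) ?_ ?_ ?_
      (hNx.trans hx) ?_
    · exact (((id _).snd.snd.fst : PolyComputable Q _ fun q : Σ a, Fin (N a + 1) =>
        .int ((N q.1 : ℕ) : ℤ)).sub (id _).fst)
    · rintro ⟨a, i, hi⟩
      simp only [Data.Truthy, ne_eq, Data.int.injEq]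
      omega
    · have hi : PolyComputable Q (fun q : Σ a, Fin (N a) => st q.1 q.2)
          fun q => .int ((q.2 : ℕ) : ℤ) := (id _).fst
      refine ((hi.add (const _ 1)).congr fun q => ?_).pair
        (((hi.pair ((id _).snd.fst.pair (id _).snd.snd.snd)).comp hstep).pair (id _).snd.snd)
      push_cast
      rfl
    · refine .of_le (f' := fun q => ((N q.1) + 1 + (acc q.1 q.2).size + ((N q.1) + 1) +
        (x q.1).size + 3)) ?_ ?_
      · rintro ⟨a, i, hi⟩
        simp only [st, Data.size]
        have h1 := Data.size_int_natCast_le i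
        have h2 := Data.size_int_natCast_le (N a)
        simp only [Data.size] at h1 h2
        omega
      · have hN' := (hNx.trans hx).comp (fun q : Σ a, Fin (N a + 1) => q.1)
        have hx' := hx.comp (fun q : Σ a, Fin (N a + 1) => q.1)
        exact (((((hN'.add (.const 1 _)).add (hacc.trans hx')).add (hN'.add (.const 1 _))).add
          hx').add (.const 3 _))
  have hinit : PolyComputable Q x fun a => st a 0 :=
    (const x 0).pair (h0.pair (hN.pair (id x)))
  exact (hinit.comp hloop).snd.fst

theorem length {L : α → List Data} (h : PolyComputable Q x fun a => .ofList (L a)) :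
    PolyComputable Q x fun a => .int (L a).length := by
  let st : α → ℕ → Data := fun a i => .pair (.int i) (.ofList ((L a).drop i))
  have hsize : ∀ a, (Data.ofList (L a)).size ≤ (st a 0).size := fun a => by
    simp only [st, Data.size, List.drop_zero]; omega
  have hlen : PolyBounded (fun a => (L a).length) fun a => (st a 0).size :=
    .of_le (fun a => (Data.length_lt_size_ofList _).le.trans (hsize a)) (.refl _)
  have hloop := while_loop (Q := Q) (fun a => (L a).length) st
    (b := fun q => .ofBool (Data.ofList ((L q.1).drop q.2)).isPair) (id _).snd.isPair ?_ ?_ hlen ?_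
  · exact ((((const x 0).pair h).congr fun a => by simp [st]).comp hloop).fst
  · rintro ⟨a, i, hi⟩
    rw [Data.truthy_ofBool]
    by_cases h' : i < (L a).length
    · rw [List.drop_eq_getElem_cons h']
      simp [Data.ofList, Data.isPair, h']
    · simp [List.drop_eq_nil_of_le (not_lt.1 h'), Data.ofList, Data.isPair, h']
  · have hi : PolyComputable Q (fun q : Σ a, Fin (L a).length => st q.1 q.2)
        fun q => .int ((q.2 : ℕ) : ℤ) := (id _).fst
    refine ((hi.add (const _ 1)).congr fun q => ?_).pair ((id _).snd.snd.congr ?_)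
    · push_cast
      rfl
    · rintro ⟨a, i, hi⟩
      simp only [st, Data.snd]
      rw [List.drop_eq_getElem_cons hi, Data.ofList]
  · refine .of_le (f' := fun q => (L q.1).length + 1 + (st q.1 0).size + 1) ?_
      ((((hlen.comp _).add (.const 1 _)).add (.refl _)).add (.const 1 _))
    rintro ⟨a, i, hi⟩
    have h1 := Data.size_int_natCast_le i
    have h2 := Data.size_ofList_drop_le (L a) i
    have h3 := hsize a
    simp only [st, Data.size] at h1 h2 h3 ⊢
    omega

theorem getElem {L : α → List Data} {i : α → ℕ} (hi : ∀ a, i a < (L a).length)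
    (hL : PolyComputable Q x fun a => .ofList (L a))
    (hix : PolyComputable Q x fun a => .int (i a)) :
    PolyComputable Q x fun a => (L a)[i a]'(hi a) := by
  have hdrop : PolyComputable Q x fun a => .ofList ((L a).drop (i a)) := by
    refine for_loop (acc := fun a k => .ofList ((L a).drop k)) hix (by simpa using hL) ?_
      (.of_le (fun a => ((hi a).trans (Data.length_lt_size_ofList _)).le) hL.size_le) ?_
    · refine (id _).snd.fst.snd.congr ?_
      rintro ⟨a, k, hk⟩
      simp only [Data.fst, Data.snd]
      rw [List.drop_eq_getElem_cons (hk.trans (hi a)), Data.ofList]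
    · exact .of_le (fun q => Data.size_ofList_drop_le _ _)
        (hL.size_le.comp fun q : Σ a, Fin (i a + 1) => q.1)
  refine hdrop.fst.congr fun a => ?_
  rw [List.drop_eq_getElem_cons (hi a)]
  rfl

/-- A bound for the values that are computed in the iterations of a loop. -/
theorem size_le_of_step {N : α → ℕ} {f : (Σ a, Fin (N a)) → Data}
    (hN : PolyBounded N fun a => (x a).size)
    (hf : PolyComputable Q (fun q : Σ a, Fin (N a) => .pair (.int (q.2 : ℕ)) (x q.1)) f) :
    PolyBounded (fun q => (f q).size) fun q => (x q.1).size := by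
  refine hf.size_le.trans (.of_le (f' := fun q => N q.1 + 1 + (x q.1).size + 1) ?_
    ((((hN.comp _).add (.const 1 _)).add (.refl _)).add (.const 1 _)))
  rintro ⟨a, i, hi⟩
  have h1 := Data.size_int_natCast_le i
  simp only [Data.size] at h1 ⊢
  omega

theorem tabulate {N : α → ℕ} {f : ∀ a, Fin (N a) → Data}
    (hN : PolyComputable Q x fun a => .int (N a))
    (hNx : PolyBounded N fun a => (x a).size)
    (hf : PolyComputable Q (fun q : Σ a, Fin (N a) => .pair (.int (q.2 : ℕ)) (x q.1))
      fun q => f q.1 q.2) :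
    PolyComputable Q x fun a => .ofList (List.ofFn (f a)) := by
  -- Pairing only prepends, so the list grows from its end and iteration `i` computes the entry with
  -- reversed index.
  let L : α → ℕ → List Data := fun a k => (List.ofFn (f a)).drop (N a - k)
  suffices PolyComputable Q x fun a => .ofList (L a (N a)) by simpa [L] using this
  have hlen : ∀ a k, (L a k).length ≤ N a := by simp [L]
  refine for_loop (acc := fun a k => .ofList (L a k)) hN ?_ ?_ hNx ?_
  · exact (const x 0).congr fun a => by
      simp only [L]
      rw [List.drop_eq_nil_of_le (by simp), Data.ofList]
  · let φ : (Σ a, Fin (N a)) → Σ a, Fin (N a) := fun q => ⟨q.1, q.2.rev⟩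
    have hrev : PolyComputable Q
        (fun q : Σ a, Fin (N a) => .pair (.int q.2) (.pair (.ofList (L q.1 q.2)) (x q.1)))
        fun q => .pair (.int ((φ q).2 : ℕ)) (x (φ q).1) := by
      have hx : PolyComputable Q
          (fun q : Σ a, Fin (N a) => .pair (.int q.2) (.pair (.ofList (L q.1 q.2)) (x q.1)))
          fun q => x q.1 := (id _).snd.snd
      have hi : PolyComputable Q
          (fun q : Σ a, Fin (N a) => .pair (.int q.2) (.pair (.ofList (L q.1 q.2)) (x q.1)))
          fun q => .int ((q.2 : ℕ) : ℤ) := (id _).fst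
      refine ((((hN.of_env hx).sub hi).sub (const _ 1)).congr ?_).pair hx
      rintro ⟨a, i, hi⟩
      simp only [φ, Fin.rev]
      congr 1
      omega
    refine ((hf.of_env hrev).pair (id _).snd.fst).congr ?_
    rintro ⟨a, i, hi⟩
    have hlt : N a - (i + 1) < (List.ofFn (f a)).length := by simp; omega
    simp only [L, φ, Data.fst, Data.snd]
    rw [List.drop_eq_getElem_cons hlt, Data.ofList, show N a - (i + 1) + 1 = N a - i by omega]
    simp [Fin.rev]
  · obtain ⟨p, hp⟩ := size_le_of_step hNx hf
    refine PolyBounded.of_le (f' := fun q => 1 + N q.1 * (p.eval (x q.1).size + 1)) ?_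
      ((PolyBounded.const 1 _).add ((hNx.comp fun q : Σ a, Fin (N a + 1) => q.1).mul
        (PolyBounded.add ⟨p, fun q => le_rfl⟩ (.const 1 _))))
    rintro ⟨a, k, hk⟩
    refine (Data.size_ofList_le (B := p.eval (x a).size) fun d hd => ?_).trans ?_
    · obtain ⟨i, rfl⟩ := List.mem_ofFn.1 (List.mem_of_mem_drop hd)
      exact hp ⟨a, i⟩
    · have := hlen a k
      gcongr

theorem sum {N : α → ℕ} {g : ∀ a, Fin (N a) → ℤ}
    (hN : PolyComputable Q x fun a => .int (N a))
    (hNx : PolyBounded N fun a => (x a).size)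
    (hg : PolyComputable Q (fun q : Σ a, Fin (N a) => .pair (.int (q.2 : ℕ)) (x q.1))
      fun q => .int (g q.1 q.2)) :
    PolyComputable Q x fun a => .int (∑ i, g a i) := by
  let g' : α → ℕ → ℤ := fun a i => if h : i < N a then g a ⟨i, h⟩ else 0
  have hgg' : ∀ a, ∑ i, g a i = ∑ i ∈ Finset.range (N a), g' a i := fun a => by
    rw [← Fin.sum_univ_eq_sum_range]
    simp [g']
  suffices PolyComputable Q x fun a => .int (∑ i ∈ Finset.range (N a), g' a i) from
    this.congr fun a => by rw [hgg']
  refine for_loop (acc := fun a k => .int (∑ i ∈ Finset.range k, g' a i)) hN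
    ((const x 0).congr fun a => by simp) ?_ hNx ?_
  · refine ((id _).snd.fst.add (hg.of_env (φ := fun q => q) ((id _).fst.pair
      (id _).snd.snd))).congr ?_
    rintro ⟨a, i, hi⟩
    rw [Finset.sum_range_succ]
    simp [g', hi]
  · obtain ⟨p, hp⟩ := size_le_of_step hNx hg
    refine PolyBounded.of_le (f' := fun q => N q.1 + p.eval (x q.1).size + 1) ?_
      (((hNx.comp fun q : Σ a, Fin (N a + 1) => q.1).add ⟨p, fun q => le_rfl⟩).add (.const 1 _))
    rintro ⟨a, k, hk⟩
    rw [Data.size_int_le_iff]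
    have hle : ∀ i, (g' a i).natAbs ≤ 2 ^ p.eval (x a).size := by
      intro i
      by_cases hi : i < N a
      · simp only [g', dif_pos hi]
        exact (Data.natAbs_lt_size _).le.trans (Nat.pow_le_pow_right two_pos (hp ⟨a, i, hi⟩))
      · simp [g', hi]
    have hsum : (∑ i ∈ Finset.range k, g' a i).natAbs ≤ k * 2 ^ p.eval (x a).size := by
      clear hk
      induction k with
      | zero => simp
      | succ k ih =>
        rw [Finset.sum_range_succ, Nat.succ_mul]
        exact (Int.natAbs_add_le _ _).trans (add_le_add ih (hle k))
    calc (∑ i ∈ Finset.range k, g' a i).natAbs ≤ k * 2 ^ p.eval (x a).size := hsum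
      _ < 2 ^ N a * 2 ^ p.eval (x a).size := by
        have : k < 2 ^ N a := (Nat.lt_succ_iff.1 hk).trans_lt Nat.lt_two_pow_self
        gcongr
      _ = 2 ^ (N a + p.eval (x a).size) := (pow_add _ _ _).symm

end PolyComputable

end EnergyGames

/-! ### The query instance, its values and its computation. -/

namespace EnergyGames

namespace Instance

theorem n_lt_size_encode (I : Instance) : I.n < I.encode.size := by
  simpa [encode] using Data.length_lt_size_ofList (List.ofFn fun u : Fin I.n =>
    Data.pair (Data.ofBool (I.graph.alice u))
      (Data.ofList (List.ofFn fun v : Fin I.n => Data.ofOption (I.graph.weight u v))))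

theorem natAbs_wt_lt (I : Instance) (u v : Fin I.n) :
    (I.graph.wt u v).natAbs < 2 ^ I.encode.size := by
  have h1 : (Data.pair (Data.ofBool (I.graph.alice u))
      (Data.ofList (List.ofFn fun v : Fin I.n => Data.ofOption (I.graph.weight u v)))).size <
      I.encode.size :=
    Data.size_lt_size_ofList (List.mem_ofFn.2 ⟨u, rfl⟩)
  have h2 : (Data.ofOption (I.graph.weight u v)).size <
      (Data.ofList (List.ofFn fun v : Fin I.n => Data.ofOption (I.graph.weight u v))).size :=
    Data.size_lt_size_ofList (List.mem_ofFn.2 ⟨v, rfl⟩)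
  have h3 : (Data.int (I.graph.wt u v)).size ≤ (Data.ofOption (I.graph.weight u v)).size := by
    unfold GameGraph.wt
    cases I.graph.weight u v with
    | none => simp [Data.ofOption]
    | some w => simp only [Data.ofOption, Option.getD_some, Data.size]; omega
  refine (Data.natAbs_lt_size _).trans (Nat.pow_lt_pow_right (by norm_num) ?_)
  simp only [Data.size] at h1 h2 h3 ⊢
  omega

theorem abs_wt_le (I : Instance) (u v : Fin I.n) :
    |(I.graph.wt u v : ℚ)| ≤ (2 ^ I.encode.size : ℕ) := by
  have h := (I.natAbs_wt_lt u v).le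
  have : |I.graph.wt u v| ≤ (2 ^ I.encode.size : ℕ) := by
    rw [Int.abs_eq_natAbs]
    exact_mod_cast h
  exact_mod_cast this

/-- A number that exceeds the number of nodes and the weights of the bipartite form. -/
def weightBound (I : Instance) : ℤ :=
  3 * I.n + 1 + 2 * ∑ u, ∑ v, I.graph.wt u v * I.graph.wt u v

theorem three_mul_n_le_weightBound (I : Instance) : 3 * I.n + 1 ≤ I.weightBound := by
  have : 0 ≤ ∑ u, ∑ v, I.graph.wt u v * I.graph.wt u v :=
    Finset.sum_nonneg fun u _ => Finset.sum_nonneg fun v _ => mul_self_nonneg _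
  unfold weightBound
  linarith

/-- For integers `|z| ≤ z * z`, so a sum of squares can replace the maximum of the absolute values;
it needs no comparisons. -/
theorem two_mul_abs_wt_le_weightBound (I : Instance) (u v : Fin I.n) :
    2 * |I.graph.wt u v| + 1 ≤ I.weightBound := by
  have h1 : I.graph.wt u v * I.graph.wt u v ≤ ∑ v, I.graph.wt u v * I.graph.wt u v :=
    Finset.single_le_sum (f := fun v => I.graph.wt u v * I.graph.wt u v)
      (fun v _ => mul_self_nonneg _) (Finset.mem_univ v)
  have h2 : ∑ v, I.graph.wt u v * I.graph.wt u v ≤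
      ∑ u, ∑ v, I.graph.wt u v * I.graph.wt u v :=
    Finset.single_le_sum (f := fun u => ∑ v, I.graph.wt u v * I.graph.wt u v)
      (fun u _ => Finset.sum_nonneg fun v _ => mul_self_nonneg _) (Finset.mem_univ u)
  have h3 : |I.graph.wt u v| ≤ I.graph.wt u v * I.graph.wt u v := by
    rw [← abs_mul_abs_self]
    rcases (abs_nonneg (I.graph.wt u v)).eq_or_lt with h | h
    · simp [← h]
    · nlinarith
  unfold weightBound
  have : (0 : ℤ) ≤ I.n := Int.natCast_nonneg _
  linarith

/-- The bipartite form of the graph of an instance. -/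
def bipartiteGraph (I : Instance) : GameGraph (Fin (3 * I.n)) :=
  I.graph.bipartite finProdFinEquiv.symm

theorem bipartiteGraph_alice_zero (I : Instance) (s : Fin I.n) :
    I.bipartiteGraph.alice (finProdFinEquiv (0, s)) = true :=
  GameGraph.bipartite_alice_iff.2 (by rw [Equiv.symm_apply_apply])

theorem bipartiteGraph_alice_one (I : Instance) (s : Fin I.n) :
    I.bipartiteGraph.alice (finProdFinEquiv (1, s)) = false :=
  GameGraph.bipartite_bob_iff.2 (by rw [Equiv.symm_apply_apply]; exact one_ne_zero)

/-- The complete bipartite instance whose solution yields the value of the node `s`. -/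
def query (I : Instance) (s : Fin I.n) : Instance where
  n := 3 * I.n
  graph := I.bipartiteGraph.complete (finProdFinEquiv (0, s)) (finProdFinEquiv (1, s))
    (I.bipartiteGraph_alice_zero s) (I.bipartiteGraph_alice_one s)
    (I.weightBound * I.weightBound)

theorem query_completeBipartite (I : Instance) (s : Fin I.n) :
    CompleteBipartiteGraphs (I.query s) :=
  GameGraph.complete_isCompleteBipartite (hs := I.bipartiteGraph_alice_zero s)
    (hd := I.bipartiteGraph_alice_one s)

theorem abs_bipartiteGraph_wt_le (I : Instance) (x y : Fin (3 * I.n)) :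
    |(I.bipartiteGraph.wt x y : ℚ)| + 1 ≤ I.weightBound := by
  have := GameGraph.abs_bipartite_wt_le (G := I.graph) (e := finProdFinEquiv.symm)
    (W := ((I.weightBound : ℚ) - 1) / 2) (fun u v => by
      have := I.two_mul_abs_wt_le_weightBound u v
      have h : (2 * |(I.graph.wt u v : ℚ)| + 1) ≤ I.weightBound := by exact_mod_cast this
      linarith) x y
  unfold bipartiteGraph
  linarith

/-- `weightBound` dominates both factors of the required lower bound for `Z`, so its square is a
valid choice. -/
theorem card_mul_weightBound_le (I : Instance) :
    (Fintype.card (Fin (3 * I.n)) : ℚ) * I.weightBound ≤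
      (I.weightBound * I.weightBound : ℤ) := by
  have h1 := I.three_mul_n_le_weightBound
  have h2 : (3 * I.n + 1 : ℚ) ≤ I.weightBound := by exact_mod_cast h1
  have h3 : (0 : ℚ) ≤ I.n := Nat.cast_nonneg _
  rw [Fintype.card_fin]
  push_cast
  gcongr
  · linarith
  · linarith

theorem bipartiteGraph_edge_one (I : Instance) (s : Fin I.n) (y : Fin (3 * I.n))
    (h : I.bipartiteGraph.Edge (finProdFinEquiv (1, s)) y) : y = finProdFinEquiv (0, s) :=
  GameGraph.bipartite_edge_to_alice.1 h

theorem query_minEnergy (I : Instance) (s : Fin I.n) :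
    Data.ofENat (I.graph.minEnergy s) =
      .int ((Data.ofENat ((I.query s).graph.minEnergy (finProdFinEquiv (0, s)))).toInt / 2) := by
  have h := GameGraph.complete_minEnergy (G := I.bipartiteGraph)
    (s := finProdFinEquiv (0, s)) (d := finProdFinEquiv (1, s))
    (hs := I.bipartiteGraph_alice_zero s) (hd := I.bipartiteGraph_alice_one s)
    GameGraph.bipartite_edge_ne (I.bipartiteGraph_edge_one s) (W := I.weightBound)
    (fun x y => by linarith [I.abs_bipartiteGraph_wt_le x y])
    (by linarith [I.abs_bipartiteGraph_wt_le (finProdFinEquiv (0, s)) (finProdFinEquiv (0, s)),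
      abs_nonneg (I.bipartiteGraph.wt (finProdFinEquiv (0, s)) (finProdFinEquiv (0, s)) : ℚ)])
    I.card_mul_weightBound_le
  have h' : (I.query s).graph.minEnergy (finProdFinEquiv (0, s)) =
    I.bipartiteGraph.minEnergy (finProdFinEquiv (0, s)) := h
  rw [h']
  exact GameGraph.ofENat_minEnergy_eq_bipartite (e := finProdFinEquiv.symm) s

theorem query_meanValue (I : Instance) (s : Fin I.n) :
    I.graph.meanValue s = (I.query s).graph.meanValue (finProdFinEquiv (0, s)) := by
  have h := GameGraph.complete_meanValue (G := I.bipartiteGraph)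
    (s := finProdFinEquiv (0, s)) (d := finProdFinEquiv (1, s))
    (hs := I.bipartiteGraph_alice_zero s) (hd := I.bipartiteGraph_alice_one s)
    GameGraph.bipartite_edge_ne (I.bipartiteGraph_edge_one s) (W := I.weightBound)
    I.abs_bipartiteGraph_wt_le I.card_mul_weightBound_le
  have h' : (I.query s).graph.meanValue (finProdFinEquiv (0, s)) =
    I.bipartiteGraph.meanValue (finProdFinEquiv (0, s)) := h
  rw [h']
  exact (GameGraph.bipartite_meanValue (e := finProdFinEquiv.symm) s).symm

end Instance

/-! ### The reduction as a program -/

namespace PolyComputable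

variable {Q : Problem} {α : Type} {x : α → Data}

theorem mod {m n : α → ℕ} (h : PolyComputable Q x fun a => .int (m a))
    (h' : PolyComputable Q x fun a => .int (n a)) :
    PolyComputable Q x fun a => .int (m a % n a : ℕ) :=
  (h.sub (h'.mul (h.div h'))).congr fun a => by
    rw [Int.natCast_mod, Int.emod_def]

theorem option_getD {o : α → Option ℤ} {k : α → ℤ}
    (h : PolyComputable Q x fun a => .ofOption (o a))
    (h' : PolyComputable Q x fun a => .int (k a)) :
    PolyComputable Q x fun a => .int ((o a).getD (k a)) :=
  (ite_truthy (P := fun a => (o a).isSome) h.isPair (fun a => by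
    rw [Data.truthy_ofBool]; cases o a <;> simp [Data.ofOption, Data.isPair]) h.fst h').congr
    fun a => by cases o a <;> simp [Data.ofOption, Data.fst]

theorem option_some {k : α → ℤ} (h : PolyComputable Q x fun a => .int (k a)) :
    PolyComputable Q x fun a => .ofOption (some (k a)) :=
  h.pair (const x 0)

theorem option_none (x : α → Data) : PolyComputable Q x fun _ => .ofOption none := const x 0

theorem option_map_two_mul {o : α → Option ℤ}
    (h : PolyComputable Q x fun a => .ofOption (o a)) :
    PolyComputable Q x fun a => .ofOption ((o a).map (2 * ·)) :=
  (ite_truthy (P := fun a => (o a).isSome) h.isPair (fun a => by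
    rw [Data.truthy_ofBool]; cases o a <;> simp [Data.ofOption, Data.isPair])
    (option_some ((const x 2).mul h.fst.toInt)) (option_none x)).congr
    fun a => by cases o a <;> simp [Data.ofOption, Data.fst, Data.toInt]

theorem option_ite {P : α → Prop} [DecidablePred P] {o o' : α → Option ℤ}
    (hP : PolyComputable Q x fun a => .ofBool (decide (P a)))
    (h : PolyComputable Q x fun a => .ofOption (o a))
    (h' : PolyComputable Q x fun a => .ofOption (o' a)) :
    PolyComputable Q x fun a => .ofOption (if P a then o a else o' a) :=
  (hP.ite h h').congr fun _ => (apply_ite Data.ofOption _ _ _).symm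

theorem int_ite {P : α → Prop} [DecidablePred P] {m n : α → ℤ}
    (hP : PolyComputable Q x fun a => .ofBool (decide (P a)))
    (h : PolyComputable Q x fun a => .int (m a)) (h' : PolyComputable Q x fun a => .int (n a)) :
    PolyComputable Q x fun a => .int (if P a then m a else n a) :=
  (hP.ite h h').congr fun _ => (apply_ite Data.int _ _ _).symm

section Instance

variable {I : α → Instance} {u v : ∀ a, Fin (I a).n}

theorem n (hI : PolyComputable Q x fun a => (I a).encode) :
    PolyComputable Q x fun a => .int (I a).n :=
  hI.length.congr fun a => by simp

theorem n_polyBounded (hI : PolyComputable Q x fun a => (I a).encode) :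
    PolyBounded (fun a => (I a).n) fun a => (x a).size :=
  .of_le (fun a => (I a).n_lt_size_encode.le) hI.size_le

theorem alice (hI : PolyComputable Q x fun a => (I a).encode)
    (hu : PolyComputable Q x fun a => .int (u a : ℕ)) :
    PolyComputable Q x fun a => .ofBool ((I a).graph.alice (u a)) :=
  (getElem (fun a => by simp) hI hu).fst.congr fun a => by simp [Data.fst]

theorem weight (hI : PolyComputable Q x fun a => (I a).encode)
    (hu : PolyComputable Q x fun a => .int (u a : ℕ))
    (hv : PolyComputable Q x fun a => .int (v a : ℕ)) :
    PolyComputable Q x fun a => .ofOption ((I a).graph.weight (u a) (v a)) := by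
  have hrow : PolyComputable Q x fun a =>
      .ofList (List.ofFn fun v => Data.ofOption ((I a).graph.weight (u a) v)) :=
    (getElem (fun a => by simp) hI hu).snd.congr fun a => by simp [Data.snd]
  exact (getElem (fun a => by simp) hrow hv).congr fun a => by simp

theorem weightBound (hI : PolyComputable Q x fun a => (I a).encode) :
    PolyComputable Q x fun a => .int (I a).weightBound := by
  refine (((const x 3).mul hI.n).add (const x 1)).add ((const x 2).mul
    (sum hI.n hI.n_polyBounded (sum (N := fun q : Σ a, Fin (I a).n => (I q.1).n) ?_ ?_ ?_)))
  · exact hI.n.of_env (id _).snd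
  · exact (hI.of_env (φ := fun q : Σ a, Fin (I a).n => q.1) (id _).snd).n_polyBounded
  · have h := weight (x := fun q : Σ q' : (Σ a, Fin (I a).n), Fin (I q'.1).n =>
        Data.pair (.int (q.2 : ℕ)) (.pair (.int (q.1.2 : ℕ)) (x q.1.1))) (Q := Q)
      (I := fun q => I q.1.1) (u := fun q => q.1.2) (v := fun q => q.2)
      (hI.of_env (id _).snd.snd) (id _).snd.fst (id _).fst
    exact (h.option_getD (const _ 0)).mul (h.option_getD (const _ 0))

theorem bipartiteWeight {k l : α → Fin 3} (hI : PolyComputable Q x fun a => (I a).encode)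
    (hk : PolyComputable Q x fun a => .int (k a : ℕ))
    (hu : PolyComputable Q x fun a => .int (u a : ℕ))
    (hl : PolyComputable Q x fun a => .int (l a : ℕ))
    (hv : PolyComputable Q x fun a => .int (v a : ℕ)) :
    PolyComputable Q x fun a =>
      .ofOption ((I a).graph.bipartiteWeight (k a, u a) (l a, v a)) := by
  have hw := (hI.weight hu hv).option_map_two_mul
  have hkind : ∀ {m : α → Fin 3} (c : Fin 3), PolyComputable Q x (fun a => .int (m a : ℕ)) →
      PolyComputable Q x fun a => .ofBool (decide (m a = c)) := fun c hm =>
    (hm.decide_eq (const x (c : ℕ))).congr fun a => by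
      congr 2; simp [Fin.ext_iff]
  have heq : PolyComputable Q x fun a => .ofBool (decide (u a = v a)) :=
    (hu.decide_eq hv).congr fun a => by congr 2; simp [Fin.ext_iff]
  have ha : PolyComputable Q x fun a => .ofBool (decide ((I a).graph.alice (u a) = true)) :=
    (hI.alice hu).congr fun a => by simp
  have hb : PolyComputable Q x fun a => .ofBool (decide ((I a).graph.alice (u a) = false)) :=
    ha.decide_not.congr fun a => by simp
  exact (hkind 0 hk).option_ite
    (ha.option_ite ((hkind 1 hl).option_ite hw (option_none x))
      (((hkind 2 hl).decide_and heq).option_ite (option_some (const x 0)) (option_none x)))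
    ((hkind 0 hl).option_ite
      (((hkind 2 hk).decide_and hb).option_ite hw
        (heq.option_ite (option_some (const x 0)) (option_none x))) (option_none x))

theorem query_alice {i : ∀ a, Fin (3 * (I a).n)}
    (hI : PolyComputable Q x fun a => (I a).encode)
    (hi : PolyComputable Q x fun a => .int (i a : ℕ)) :
    PolyComputable Q x fun a => .ofBool ((I a).bipartiteGraph.alice (i a)) :=
  ((hi.div hI.n).decide_eq (const x 0)).congr fun a => by
    congr 1
    simp only [Instance.bipartiteGraph, GameGraph.bipartite, finProdFinEquiv_symm_apply]
    congr 1
    rw [Fin.ext_iff, Fin.coe_divNat]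
    norm_cast

theorem query_weight {s : ∀ a, Fin (I a).n} {i j : ∀ a, Fin (3 * (I a).n)}
    (hI : PolyComputable Q x fun a => (I a).encode)
    (hs : PolyComputable Q x fun a => .int (s a : ℕ))
    (hi : PolyComputable Q x fun a => .int (i a : ℕ))
    (hj : PolyComputable Q x fun a => .int (j a : ℕ)) :
    PolyComputable Q x fun a => .ofOption (((I a).query (s a)).graph.weight (i a) (j a)) := by
  have hkind : ∀ {i : ∀ a, Fin (3 * (I a).n)}, PolyComputable Q x (fun a => .int (i a : ℕ)) →
      PolyComputable Q x fun a => .int ((i a).divNat : ℕ) := fun hi =>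
    (hi.div hI.n).congr fun a => by rw [Fin.coe_divNat]; norm_cast
  have hnode : ∀ {i : ∀ a, Fin (3 * (I a).n)}, PolyComputable Q x (fun a => .int (i a : ℕ)) →
      PolyComputable Q x fun a => .int ((i a).modNat : ℕ) := fun hi =>
    (hi.mod hI.n).congr fun a => by rw [Fin.coe_modNat]
  have hw := hI.bipartiteWeight (hkind hi) (hnode hi) (hkind hj) (hnode hj)
  have hai : PolyComputable Q x fun a =>
      .ofBool (decide ((I a).bipartiteGraph.alice (i a) = true)) :=
    (hI.query_alice hi).congr fun a => by simp
  have haj : PolyComputable Q x fun a =>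
      .ofBool (decide ((I a).bipartiteGraph.alice (j a) = true)) :=
    (hI.query_alice hj).congr fun a => by simp
  have heq : PolyComputable Q x fun a => .ofBool (decide
      ((I a).bipartiteGraph.alice (i a) = (I a).bipartiteGraph.alice (j a))) :=
    (hai.ite haj haj.decide_not).congr fun a => by
      cases (I a).bipartiteGraph.alice (i a) <;>
        cases (I a).bipartiteGraph.alice (j a) <;> rfl
  -- The pair `(0, s)` has number `s`, so comparing the numbers suffices.
  have hjs : PolyComputable Q x fun a => .ofBool (decide (j a = finProdFinEquiv (0, s a))) :=
    (hj.decide_eq hs).congr fun a => by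
      congr 2
      rw [Fin.ext_iff, finProdFinEquiv_apply_val]
      norm_num
  have hZ := hI.weightBound.mul hI.weightBound
  exact heq.option_ite (option_none x) (option_some (hw.option_getD
    (hai.int_ite ((const x (-16)).mul hZ)
      (hjs.int_ite ((const x 4).mul hZ) ((const x 32).mul hZ)))))

theorem query {s : ∀ a, Fin (I a).n} (hI : PolyComputable Q x fun a => (I a).encode)
    (hs : PolyComputable Q x fun a => .int (s a : ℕ)) :
    PolyComputable Q x fun a => ((I a).query (s a)).encode := by
  have h3n : PolyComputable Q x fun a => .int (3 * (I a).n : ℕ) :=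
    ((const x 3).mul hI.n).congr fun a => by push_cast; rfl
  have h3nb : PolyBounded (fun a => 3 * (I a).n) fun a => (x a).size :=
    (PolyBounded.const 3 _).mul hI.n_polyBounded
  refine tabulate (N := fun a => 3 * (I a).n) h3n h3nb (pair ?_ ?_)
  · exact (hI.of_env (φ := fun q : Σ a, Fin (3 * (I a).n) => q.1) (id _).snd).query_alice (id _).fst
  · have hx : PolyComputable Q
        (fun q : Σ a, Fin (3 * (I a).n) => .pair (.int (q.2 : ℕ)) (x q.1)) fun q => x q.1 :=
      (id _).snd
    refine tabulate (N := fun q : Σ a, Fin (3 * (I a).n) => 3 * (I q.1).n) (h3n.of_env hx)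
      ((h3nb.comp _).trans hx.size_le) ?_
    exact query_weight (x := fun q : Σ q' : (Σ a, Fin (3 * (I a).n)), Fin (3 * (I q'.1).n) =>
        Data.pair (.int (q.2 : ℕ)) (.pair (.int (q.1.2 : ℕ)) (x q.1.1))) (Q := Q)
      (I := fun q => I q.1.1) (s := fun q => s q.1.1) (i := fun q => q.1.2) (j := fun q => q.2)
      (hI.of_env (id _).snd.snd) (hs.of_env (id _).snd.snd) (id _).snd.fst (id _).fst

end Instance

end PolyComputable

/-! ### Equivalence of the problems -/

/-- The problem to compute the value `f I s` of every node `s` of an instance `I` in the class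
`C`. -/
def nodeValueProblem (C : Instance → Prop) (f : ∀ I : Instance, Fin I.n → Data) : Problem where
  Inst := {I : Instance // C I}
  encode I := I.1.encode
  encode_injective := Instance.encode_injective.comp Subtype.val_injective
  answer I := Data.ofList (List.ofFn (f I.1))

section NodeValues

variable {f : ∀ I : Instance, Fin I.n → Data}

theorem nodeValueProblem_size_answer_le (C : Instance → Prop)
    (hsize : PolyBounded (fun q : Σ I : Instance, Fin I.n => (f q.1 q.2).size)
      fun q => q.1.encode.size) :
    PolyBounded (fun I => ((nodeValueProblem C f).answer I).size)
      fun I => ((nodeValueProblem C f).encode I).size := by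
  obtain ⟨p, hp⟩ := hsize
  refine PolyBounded.of_le (f' := fun I : {I : Instance // C I} =>
      1 + I.1.encode.size * (p.eval I.1.encode.size + 1)) (fun I => ?_)
    ((PolyBounded.const 1 _).add ((PolyBounded.refl _).mul
      (PolyBounded.add ⟨p, fun q => le_rfl⟩ (.const 1 _))))
  refine (Data.size_ofList_le (B := p.eval I.1.encode.size) fun d hd => ?_).trans ?_
  · obtain ⟨s, rfl⟩ := List.mem_ofFn.1 hd
    exact hp ⟨I.1, s⟩
  · have := I.1.n_lt_size_encode.le
    rw [List.length_ofFn]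
    gcongr

/-- Only `post` differs between the two games: it recovers the value of `s` from one entry of the
oracle's answer to the query for `s`. -/
theorem nodeValueProblem_equivalent
    (hsize : PolyBounded (fun q : Σ I : Instance, Fin I.n => (f q.1 q.2).size)
      fun q => q.1.encode.size)
    (post : Data → Data)
    (hpost : ∀ {Q : Problem} {α : Type} {x y : α → Data}, PolyComputable Q x y →
      PolyComputable Q x fun a => post (y a))
    (hf : ∀ I s, f I s = post (f (I.query s) (finProdFinEquiv (0, s)))) :
    PolyTimeEquivalent (nodeValueProblem CompleteBipartiteGraphs f)
      (nodeValueProblem AllGraphs f) := by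
  constructor
  · exact PolyComputable.oracle (Q := nodeValueProblem AllGraphs f)
      (nodeValueProblem_size_answer_le _ hsize)
      (I := fun I : {I : Instance // CompleteBipartiteGraphs I} => ⟨I.1, trivial⟩) (.id _)
  · let Q := nodeValueProblem CompleteBipartiteGraphs f
    have hI : PolyComputable Q (nodeValueProblem AllGraphs f).encode
        fun I : {I : Instance // AllGraphs I} => I.1.encode := .id _
    refine PolyComputable.tabulate (N := fun I : {I : Instance // AllGraphs I} => I.1.n)
      hI.n hI.n_polyBounded ?_
    let x : (Σ I : {I : Instance // AllGraphs I}, Fin I.1.n) → Data :=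
      fun q => .pair (.int (q.2 : ℕ)) q.1.1.encode
    have hquery : PolyComputable Q x fun q => (q.1.1.query q.2).encode :=
      PolyComputable.query (I := fun q : Σ I : {I : Instance // AllGraphs I}, Fin I.1.n => q.1.1)
        (s := fun q => q.2)
        (PolyComputable.id x).snd (PolyComputable.id x).fst
    have hanswer : PolyComputable Q x fun q => .ofList (List.ofFn (f (q.1.1.query q.2))) :=
      PolyComputable.oracle (Q := Q) (nodeValueProblem_size_answer_le _ hsize)
        (I := fun q : Σ I : {I : Instance // AllGraphs I}, Fin I.1.n =>
          ⟨q.1.1.query q.2, q.1.1.query_completeBipartite q.2⟩) hquery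
    have hlt : ∀ q : Σ I : {I : Instance // AllGraphs I}, Fin I.1.n,
        (q.2 : ℕ) < (List.ofFn (f (q.1.1.query q.2))).length := fun q => by
      rw [List.length_ofFn]
      exact q.2.2.trans_le (Nat.le_mul_of_pos_left _ (by norm_num))
    -- Entry `s` of the answer belongs to the node `(0, s)`, whose number is `s`.
    refine (hpost (PolyComputable.getElem hlt hanswer (PolyComputable.id x).fst)).congr fun q => ?_
    rw [hf, List.getElem_ofFn]
    congr 2

end NodeValues

theorem size_ofENat_minEnergy_le :
    PolyBounded (fun q : Σ I : Instance, Fin I.n => (Data.ofENat (q.1.graph.minEnergy q.2)).size)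
      fun q => q.1.encode.size := by
  refine .of_le (f' := fun q => q.1.encode.size + q.1.encode.size + 3) ?_
    (((PolyBounded.refl _).add (.refl _)).add (.const 3 _))
  rintro ⟨I, s⟩
  simp only
  by_cases h : I.graph.minEnergy s = ⊤
  · simp [Data.ofENat, h, Data.size]
  · have hle := I.graph.minEnergy_le (W := 2 ^ I.encode.size) I.abs_wt_le h
    rw [Data.ofENat, if_neg h, Data.size_int_le_iff, Int.natAbs_natCast]
    have h1 : (I.graph.minEnergy s).toNat ≤ I.n * (2 * 2 ^ I.encode.size) := by
      have := ENat.toNat_le_toNat hle (ENat.natCast_ne_top _)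
      rwa [ENat.toNat_natCast, Fintype.card_fin] at this
    have h2 : I.n < 2 ^ I.encode.size := I.n_lt_size_encode.trans Nat.lt_two_pow_self
    calc (I.graph.minEnergy s).toNat ≤ I.n * (2 * 2 ^ I.encode.size) := h1
      _ < 2 ^ I.encode.size * (2 * 2 ^ I.encode.size) := by gcongr
      _ = 2 ^ (I.encode.size + I.encode.size + 1) := by ring
      _ ≤ 2 ^ (I.encode.size + I.encode.size + 2) := Nat.pow_le_pow_right two_pos (by omega)

theorem size_ofRat_meanValue_le :
    PolyBounded (fun q : Σ I : Instance, Fin I.n => (Data.ofRat (q.1.graph.meanValue q.2)).size)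
      fun q => q.1.encode.size := by
  refine .of_le
    (f' := fun q => (q.1.encode.size + q.1.encode.size + 1) + (q.1.encode.size + 1) + 1)
    ?_ (((((PolyBounded.refl _).add (.refl _)).add (.const 1 _)).add
      ((PolyBounded.refl _).add (.const 1 _))).add (.const 1 _))
  rintro ⟨I, s⟩
  obtain ⟨a, p, hp, hpn, ha, h⟩ :=
    I.graph.exists_meanValue_eq_div (W := (2 ^ I.encode.size : ℕ)) I.abs_wt_le s
  simp only [h, Data.ofRat]
  rw [Fintype.card_fin] at hpn
  have hpZ : (p : ℤ) ≠ 0 := by exact_mod_cast hp.ne'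
  have hp2 : p < 2 ^ I.encode.size :=
    hpn.trans_lt (I.n_lt_size_encode.trans Nat.lt_two_pow_self)
  have ha' : a.natAbs ≤ p * 2 ^ I.encode.size := by
    have : |a| ≤ ((p * 2 ^ I.encode.size : ℕ) : ℤ) := by exact_mod_cast ha
    rw [Int.abs_eq_natAbs] at this
    exact_mod_cast this
  have hdiv : (a / p : ℚ) = Rat.divInt a p := by rw [Rat.divInt_eq_div, Int.cast_natCast]
  rw [hdiv]
  have hnum : (Rat.divInt a p).num.natAbs ≤ a.natAbs := by
    rcases eq_or_ne a 0 with rfl | ha0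
    · simp
    · exact Nat.le_of_dvd (Int.natAbs_pos.2 ha0) (Int.natAbs_dvd_natAbs.2 (Rat.num_dvd a hpZ))
  have hden : (Rat.divInt a p).den ≤ p :=
    Nat.le_of_dvd hp (Int.natCast_dvd_natCast.1 (Rat.den_dvd a p))
  have h1 : (Data.int (Rat.divInt a p).num).size ≤ I.encode.size + I.encode.size + 1 := by
    rw [Data.size_int_le_iff, pow_add]
    refine (hnum.trans ha').trans_lt ?_
    gcongr
  have h2 : (Data.int (Rat.divInt a p).den).size ≤ I.encode.size + 1 := by
    rw [Data.size_int_le_iff, Int.natAbs_natCast]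
    exact hden.trans_lt hp2
  rw [Data.size]
  omega

end EnergyGames

theorem mainTheorem7 :
    EnergyGames.PolyTimeEquivalent
      (EnergyGames.energyValueProblem EnergyGames.CompleteBipartiteGraphs)
      (EnergyGames.energyValueProblem EnergyGames.AllGraphs) ∧
    EnergyGames.PolyTimeEquivalent
      (EnergyGames.meanPayoffValueProblem EnergyGames.CompleteBipartiteGraphs)
      (EnergyGames.meanPayoffValueProblem EnergyGames.AllGraphs) :=
  -- Both value problems are instances of `nodeValueProblem` by definition. Energies are halved;
  -- mean payoffs are read off unchanged.
  ⟨EnergyGames.nodeValueProblem_equivalent EnergyGames.size_ofENat_minEnergy_le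
      (fun d => .int (d.toInt / 2)) (fun h => h.toInt.div (.const _ 2))
      EnergyGames.Instance.query_minEnergy,
    EnergyGames.nodeValueProblem_equivalent EnergyGames.size_ofRat_meanValue_le
      (fun d => d) (fun h => h)
      fun I s => congrArg EnergyGames.Data.ofRat (I.query_meanValue s)⟩
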